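/- Let $X$ be (the polyhedron of) a finite simplicial complex with a free simplicial involution $A:X\to X$, and let $n\ge 0$ be an integer. An *antipodal triangulation* $T$ of $X$ is a triangulation of $X$ by a finite simplicial complex (that is, a homeomorphism from the polyhedron of that complex onto $X$) such that for every simplex $s$ of $T$ the image $A(s)$ is again a simplex of $T$ and $s\cap A(s)=\emptyset$; thus $A$ induces a free involution on the vertex set $V(T)$. A labeling $L:V(T)\to\{+1,-1,\dots,+m,-m\}$ is *antipodal* if $L(A(v))=-L(v)$ for every $v\in V(T)$. An edge $[u,v]$ of $T$ is *complementary* if $L(u)=-L(v)$. The following statements are equivalent: 1. $(X,A)$ is a $\mathrm{BUT}_n$-space: for every continuous map $f:X\to\mathbb R^n$ there is $x\in X$ with $f(A(x))=f(x)$. 2. $(X,A)$ is a discrete Tucker space: for every antipodal triangulation $T$ of $X$ and every antipodal labeling $L:V(T)\to\{+1,-1,\dots,+n,-n\}$ there is a complementary edge. 3. $(X,A)$ is a Ky Fan space: for every integer $m\ge 0$, every antipodal triangulation $T$ of $X$ and every antipodal labeling $L:V(T)\to\{+1,-1,\dots,+m,-m\}$ without complementary edges there is an $n$-simplex of $T$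 whose labels are $\{k_0,-k_1,k_2,\dots,(-1)^nk_n\}$ with $1\le k_0<k_1<\dots<k_n\le m$. 4. $(X,A)$ is a $P_n$-space: for every integer $m\ge 0$, every centrally symmetric set of $2m$ (pairwise distinct) points $\{p_1,p_{-1},\dots,p_m,p_{-m}\}\subset\mathbb R^n$ with $p_{-k}=-p_k$, every antipodal triangulation $T$ of $X$ and every antipodal labeling $L:V(T)\to\{+1,-1,\dots,+m,-m\}$ there is a simplex $s$ of $T$, with labels $\ell_0,\dots,\ell_k$ say, such that the convex hull of $\{p_{\ell_0},\dots,p_{\ell_k}\}$ contains the origin. -/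

import Mathlib

/-- A self-map `A` of the polyhedron of a geometric simplicial complex `K` is simplicial if on every
simplex it is (the restriction of) an affine map which carries the vertices of that simplex onto the
vertices of a simplex of `K`. -/
def IsSimplicialSelfMap {E : Type*} [AddCommGroup E] [Module ℝ E]
    (K : Geometry.SimplicialComplex ℝ E) (A : K.space → K.space) : Prop :=
  ∀ s ∈ K.faces, ∃ g : E →ᵃ[ℝ] E,
    (∀ x : K.space, (x : E) ∈ convexHull ℝ (s : Set E) → (A x : E) = g x) ∧
    ∃ t ∈ K.faces, (t : Set E) = g '' (s : Set E)

/-- The closed subset of `X` covered by the simplex with vertex set `s`, with respect to a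
homeomorphism `h` from the polyhedron of `T` onto `X`. -/
def simplexCarrier {X F : Type*} [TopologicalSpace X] [NormedAddCommGroup F] [NormedSpace ℝ F]
    {T : Geometry.SimplicialComplex ℝ F} (h : T.space ≃ₜ X) (s : Finset F) : Set X :=
  h '' {x : T.space | (x : F) ∈ convexHull ℝ (s : Set F)}

/-- An antipodal triangulation of a space `X` with respect to `A : X → X`: a finite simplicial
complex with a homeomorphism from its polyhedron onto `X`, such that the image under `A` of every
simplex is again a simplex of the triangulation, disjoint from the original one. -/
structure AntipodalTriangulation (X : Type*) [TopologicalSpace X] (A : X → X) where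
  /-- dimension of the ambient Euclidean space -/
  dim : ℕ
  /-- the triangulating complex -/
  complex : Geometry.SimplicialComplex ℝ (EuclideanSpace ℝ (Fin dim))
  finite_faces : complex.faces.Finite
  /-- the triangulating homeomorphism -/
  homeo : complex.space ≃ₜ X
  exists_image_eq : ∀ s ∈ complex.faces, ∃ t ∈ complex.faces,
    A '' simplexCarrier homeo s = simplexCarrier homeo t
  disjoint_image : ∀ s ∈ complex.faces,
    Disjoint (simplexCarrier homeo s) (A '' simplexCarrier homeo s)

namespace AntipodalTriangulation

variable {X : Type*} [TopologicalSpace X] {A : X → X}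

/-- The vertex set `V(T)`. -/
abbrev Vertex (T : AntipodalTriangulation X A) : Type := T.complex.vertices

/-- The point of `X` at which a vertex is located. -/
def point (T : AntipodalTriangulation X A) (v : T.Vertex) : X :=
  T.homeo ⟨v.1, Geometry.SimplicialComplex.vertices_subset_space v.2⟩

theorem exists_antipode (T : AntipodalTriangulation X A) (v : T.Vertex) :
    ∃ w : T.Vertex, T.point w = A (T.point v) := by
  obtain ⟨t, ht, hAt⟩ := T.exists_image_eq {v.1} v.2
  obtain ⟨w, hw⟩ := T.complex.nonempty_of_mem_faces ht
  have hwv : w ∈ T.complex.vertices :=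
    T.complex.down_closed ht (Finset.singleton_subset_iff.2 hw) (Finset.singleton_nonempty w)
  refine ⟨⟨w, hwv⟩, ?_⟩
  have hmem : T.point ⟨w, hwv⟩ ∈ simplexCarrier T.homeo t :=
    ⟨_, subset_convexHull ℝ _ (Finset.mem_coe.2 hw), rfl⟩
  rw [← hAt] at hmem
  obtain ⟨y, ⟨x, hx, rfl⟩, hy⟩ := hmem
  rw [← hy]
  have hxv : (x : EuclideanSpace ℝ (Fin T.dim)) = v.1 := by simpa using hx
  have : x = ⟨v.1, Geometry.SimplicialComplex.vertices_subset_space v.2⟩ := Subtype.ext hxv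
  rw [this]
  rfl

/-- The map induced by `A` on the vertex set; it is the unique one with
`T.point (T.antipode v) = A (T.point v)`. -/
noncomputable def antipode (T : AntipodalTriangulation X A) (v : T.Vertex) : T.Vertex :=
  (T.exists_antipode v).choose

theorem point_antipode (T : AntipodalTriangulation X A) (v : T.Vertex) :
    T.point (T.antipode v) = A (T.point v) :=
  (T.exists_antipode v).choose_spec

end AntipodalTriangulation

/-- The label set `{+1, -1, +2, -2, …, +m, -m}`. -/
def SignedLabel (m : ℕ) : Type := {k : ℤ // k ≠ 0 ∧ |k| ≤ (m : ℤ)}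

/-- The change of sign on labels. -/
instance (m : ℕ) : Neg (SignedLabel m) :=
  ⟨fun k => ⟨-k.1, neg_ne_zero.2 k.2.1, by rw [abs_neg]; exact k.2.2⟩⟩

namespace AntipodalTriangulation

variable {X : Type*} [TopologicalSpace X] {A : X → X} {m : ℕ}

/-- An antipodal labeling: `L (A v) = - L v` for every vertex `v`. -/
def IsAntipodalLabeling (T : AntipodalTriangulation X A) (L : T.Vertex → SignedLabel m) : Prop :=
  ∀ v : T.Vertex, L (T.antipode v) = -L v

/-- Some edge `[u, v]` of the triangulation has opposite labels. -/
def HasComplementaryEdge (T : AntipodalTriangulation X A) (L : T.Vertex → SignedLabel m) : Prop :=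
  ∃ u v : T.Vertex, u ≠ v ∧
    (∃ s ∈ T.complex.faces, (s : Set (EuclideanSpace ℝ (Fin T.dim))) = {u.1, v.1}) ∧
    L u = -L v

/-- The set of labels of the vertices of the simplex with vertex set `s`. -/
def labelSet (T : AntipodalTriangulation X A) (L : T.Vertex → SignedLabel m)
    (s : Finset (EuclideanSpace ℝ (Fin T.dim))) : Set (SignedLabel m) :=
  L '' {v : T.Vertex | v.1 ∈ s}

/-- Some `n`-simplex of the triangulation has labels `k₀, -k₁, k₂, …, (-1)ⁿ kₙ` with
`1 ≤ k₀ < k₁ < ⋯ < kₙ ≤ m`. -/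
def HasAlternatingSimplex (T : AntipodalTriangulation X A) (L : T.Vertex → SignedLabel m)
    (n : ℕ) : Prop :=
  ∃ s ∈ T.complex.faces, s.card = n + 1 ∧
    ∃ k : Fin (n + 1) → ℕ, StrictMono k ∧ (∀ i, 1 ≤ k i ∧ k i ≤ m) ∧
      Subtype.val '' T.labelSet L s = Set.range fun i : Fin (n + 1) => (-1 : ℤ) ^ (i : ℕ) * (k i : ℤ)

end AntipodalTriangulation

/-- `(X, A)` is a `BUT_n`-space: every continuous map `f : X → ℝⁿ` has a point `x` with
`f (A x) = f x`. -/
def IsBUTSpace (X : Type*) [TopologicalSpace X] (A : X → X) (n : ℕ) : Prop :=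
  ∀ f : X → EuclideanSpace ℝ (Fin n), Continuous f → ∃ x : X, f (A x) = f x

/-- `(X, A)` is a (discrete) Tucker space. -/
def IsDiscreteTuckerSpace (X : Type*) [TopologicalSpace X] (A : X → X) (n : ℕ) : Prop :=
  ∀ (T : AntipodalTriangulation X A) (L : T.Vertex → SignedLabel n),
    T.IsAntipodalLabeling L → T.HasComplementaryEdge L

/-- `(X, A)` is a Ky Fan space. -/
def IsKyFanSpace (X : Type*) [TopologicalSpace X] (A : X → X) (n : ℕ) : Prop :=
  ∀ (m : ℕ) (T : AntipodalTriangulation X A) (L : T.Vertex → SignedLabel m),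
    T.IsAntipodalLabeling L → ¬ T.HasComplementaryEdge L → T.HasAlternatingSimplex L n

/-- `(X, A)` is a `P_n`-space: for every centrally symmetric set of `2m` points
`p₁, p₋₁, …, pₘ, p₋ₘ` in `ℝⁿ` with `p₋ₖ = -pₖ`, and every antipodal labeling of an antipodal
triangulation, the origin lies in the convex hull of the points that correspond to the labels of
some simplex. -/
def IsPSpace (X : Type*) [TopologicalSpace X] (A : X → X) (n : ℕ) : Prop :=
  ∀ (m : ℕ) (p : SignedLabel m → EuclideanSpace ℝ (Fin n)), Function.Injective p →
    (∀ k, p (-k) = -p k) →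
    ∀ (T : AntipodalTriangulation X A) (L : T.Vertex → SignedLabel m),
      T.IsAntipodalLabeling L →
      ∃ s ∈ T.complex.faces,
        (0 : EuclideanSpace ℝ (Fin n)) ∈ convexHull ℝ (p '' T.labelSet L s)

/-! Coincidence implies everything else by one averaging argument
(`IsBUTSpace.exists_zero_mem_convexHull`). Place the label `k` at `p k`, with `p` odd, and extend to
a continuous map that sends each simplex into the hull of its labelled points. At a coincidence `f
(A x) = f x`, antipodality puts both `f x` and `-f x` into the hull for a simplex containing `x`,
hence also their midpoint `0`. This is the `P_n` property, and injectivity of `p` plays no role.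

Points `±eₖ` turn `P_n` into Tucker: `0` lies in a hull of signed basis vectors only if two of them
are opposite. Points `±(1, k, …, kⁿ⁻¹)` give Ky Fan: linear forms on them are polynomials of degree
less than `n`, so if the signs alternated too seldom some polynomial would separate the labels from
`0`. Ky Fan implies Tucker because `n + 1` distinct moduli do not fit into `1, …, n`.

Tucker gives coincidences back. If `g = f - f ∘ A` never vanished, labelling vertices by a dominant
coordinate of `g` and its sign on a fine antipodal triangulation would leave no complementary edge.
Fine triangulations are the geometric work. The polyhedron of `K` is radially homeomorphic to part
of the boundary of the cube `[0, N]^V`, where `V` is the vertex set, and Kuhn's triangulation of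
that part is invariant under permutations of coordinates, hence under `A`; its mesh in `K` is
`O(1/N)`. -/

/-! ### Affine independence and barycentric weights. -/

section AffineCombinations

variable {E : Type*} [AddCommGroup E] [Module ℝ E]

theorem Finset.sum_dite_mem_coe {α W : Type*} [AddCommMonoid W] [DecidableEq α] (s : Finset α)
    (t : Finset s) (g : s → W) :
    ∑ v ∈ s, (if hv : v ∈ s then (if (⟨v, hv⟩ : s) ∈ t then g ⟨v, hv⟩ else 0) else 0)
      = ∑ e ∈ t, g e := by
  rw [← Finset.sum_coe_sort s]
  simp only [Finset.coe_mem, dite_true, Subtype.coe_eta]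
  rw [← Finset.sum_filter, Finset.filter_mem_eq_inter, Finset.univ_inter]

theorem affineIndependent_coe_finset_iff {s : Finset E} :
    AffineIndependent ℝ ((↑) : s → E) ↔
      ∀ c : E → ℝ, ∑ v ∈ s, c v = 0 → ∑ v ∈ s, c v • v = 0 → ∀ v ∈ s, c v = 0 := by
  classical
  rw [affineIndependent_iff]
  constructor
  · intro h c h0 h1 v hv
    refine h Finset.univ (fun v => c v) ?_ ?_ ⟨v, hv⟩ (Finset.mem_univ _)
    · rw [← h0]; exact Finset.sum_coe_sort s c
    · rw [← h1]; exact Finset.sum_coe_sort s fun v => c v • v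
  · intro h t c h0 h1 e he
    have := h (fun v => if hv : v ∈ s then (if (⟨v, hv⟩ : s) ∈ t then c ⟨v, hv⟩ else 0) else 0)
      ((Finset.sum_dite_mem_coe s t c).trans h0) ?_ e e.2
    · simpa [he] using this
    · refine Eq.trans ?_ ((Finset.sum_dite_mem_coe s t fun e => c e • (e : E)).trans h1)
      refine Finset.sum_congr rfl fun v hv => ?_
      simp only [hv, dite_true]
      split_ifs <;> simp

/-- Barycentric coordinates on a face are unique. -/
theorem AffineIndependent.eq_of_sum_eq {s : Finset E}
    (hs : AffineIndependent ℝ ((↑) : s → E)) {w w' : E → ℝ}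
    (h0 : ∑ v ∈ s, w v = ∑ v ∈ s, w' v) (h1 : ∑ v ∈ s, w v • v = ∑ v ∈ s, w' v • v)
    {v : E} (hv : v ∈ s) : w v = w' v := by
  have := affineIndependent_coe_finset_iff.1 hs (fun v => w v - w' v)
    (by simp [Finset.sum_sub_distrib, h0]) (by simp [sub_smul, Finset.sum_sub_distrib, h1]) v hv
  linarith

/-- A point of a convex hull of a finite set is a combination, with nonzero coefficients, of a
subset. -/
theorem exists_pos_weights {s : Finset E} {x : E} (hx : x ∈ convexHull ℝ (s : Set E)) :
    ∃ s' ⊆ s, ∃ w : E → ℝ, (∀ v ∈ s', 0 < w v) ∧ ∑ v ∈ s', w v = 1 ∧ ∑ v ∈ s', w v • v = x := by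
  classical
  obtain ⟨w, h0, h1, h2⟩ := Finset.mem_convexHull'.1 hx
  refine ⟨s.filter fun v => w v ≠ 0, Finset.filter_subset _ _, w, ?_, ?_, ?_⟩
  · intro v hv
    rw [Finset.mem_filter] at hv
    exact lt_of_le_of_ne (h0 v hv.1) hv.2.symm
  · rw [Finset.sum_filter_ne_zero, h1]
  · rw [← h2]
    refine Finset.sum_filter_of_ne fun v _ h hw => h ?_
    rw [hw, zero_smul]

end AffineCombinations

/-! ### Kuhn's triangulation of `ℝ^ι`. -/

section Kuhn

variable {ι : Type*}

/-- The simplices (given by their vertex sets) of Kuhn's triangulation of `ℝ^ι`: integer points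
which form a chain and any two of which differ by at most one in every coordinate. -/
structure IsKuhnCell (s : Finset (EuclideanSpace ℝ ι)) : Prop where
  integral : ∀ v ∈ s, ∀ i, ∃ k : ℤ, v i = k
  chain : ∀ u ∈ s, ∀ v ∈ s, (∀ i, u i ≤ v i) ∨ ∀ i, v i ≤ u i
  le_add_one : ∀ u ∈ s, ∀ v ∈ s, ∀ i, u i ≤ v i + 1

theorem IsKuhnCell.mono {s t : Finset (EuclideanSpace ℝ ι)} (ht : IsKuhnCell t) (h : s ⊆ t) :
    IsKuhnCell s :=
  ⟨fun v hv => ht.integral v (h hv), fun u hu v hv => ht.chain u (h hu) v (h hv),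
    fun u hu v hv => ht.le_add_one u (h hu) v (h hv)⟩

/-- The points `⌊x + θ⌋` with `0 ≤ θ < 1`; they are the vertices of the smallest simplex of Kuhn's
triangulation that contains `x`. -/
noncomputable def floorPoint (x : EuclideanSpace ℝ ι) (θ : ℝ) : EuclideanSpace ℝ ι :=
  WithLp.toLp 2 fun i => (⌊x i + θ⌋ : ℝ)

@[simp] theorem floorPoint_apply (x : EuclideanSpace ℝ ι) (θ : ℝ) (i : ι) :
    floorPoint x θ i = (⌊x i + θ⌋ : ℝ) := rfl

theorem floorPoint_mono (x : EuclideanSpace ℝ ι) {θ θ' : ℝ} (h : θ ≤ θ') (i : ι) :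
    floorPoint x θ i ≤ floorPoint x θ' i := by
  simp only [floorPoint_apply, Int.cast_le]
  exact Int.floor_le_floor (by linarith)

theorem isKuhnCell_of_subset_floorPoint {x : EuclideanSpace ℝ ι}
    {s : Finset (EuclideanSpace ℝ ι)}
    (hs : (s : Set (EuclideanSpace ℝ ι)) ⊆ floorPoint x '' Set.Ico 0 1) : IsKuhnCell s := by
  refine ⟨fun v hv i => ?_, fun u hu v hv => ?_, fun u hu v hv i => ?_⟩
  · obtain ⟨θ, -, rfl⟩ := hs hv
    exact ⟨_, rfl⟩
  · obtain ⟨θ, -, rfl⟩ := hs hu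
    obtain ⟨θ', -, rfl⟩ := hs hv
    rcases le_total θ θ' with h | h
    · exact Or.inl (floorPoint_mono x h)
    · exact Or.inr (floorPoint_mono x h)
  · obtain ⟨θ, hθ, rfl⟩ := hs hu
    obtain ⟨θ', hθ', rfl⟩ := hs hv
    simp only [floorPoint_apply]
    have : ⌊x i + θ⌋ ≤ ⌊x i + θ' + 1⌋ := Int.floor_le_floor (by linarith [hθ.2, hθ'.1])
    rw [Int.floor_add_one] at this
    exact_mod_cast this

/-- Between consecutive members of the chain some coordinate jumps by exactly one. Reading an affine
relation in that coordinate shows that the coefficients above the jump sum to zero; descending from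
the top, all of them vanish. -/
theorem IsKuhnCell.indep {s : Finset (EuclideanSpace ℝ ι)} (hs : IsKuhnCell s) :
    AffineIndependent ℝ ((↑) : s → EuclideanSpace ℝ ι) := by
  classical
  rw [affineIndependent_coe_finset_iff]
  intro c h0 h1
  -- the sum of the coefficients over every upper set vanishes
  have upper : ∀ v ∈ s, ∑ u ∈ s with ∀ i, v i ≤ u i, c u = 0 := by
    intro v hv
    by_cases hmin : ∀ u ∈ s, ∀ i, v i ≤ u i
    · rw [Finset.filter_true_of_mem hmin, h0]
    -- `p` is the predecessor of `v` in the chain `s`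
    have hpred : ∃ p : EuclideanSpace ℝ ι, (p ∈ s ∧ ¬ ∀ i, v i ≤ p i) ∧
        ∀ u : EuclideanSpace ℝ ι, u ∈ s → (¬ ∀ i, v i ≤ u i) → ∀ i, u i ≤ p i := by
      have hne : (s.filter fun u => ¬ ∀ i, v i ≤ u i).Nonempty := by
        push Not at hmin
        obtain ⟨u, hu, i, hi⟩ := hmin
        exact ⟨u, Finset.mem_filter.2 ⟨hu, fun h => absurd (h i) (not_le.2 hi)⟩⟩
      obtain ⟨p, hp⟩ := Finset.exists_maximalFor (fun u : EuclideanSpace ℝ ι => (fun i => u i)) _ hne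
      refine ⟨p, Finset.mem_filter.1 hp.1, fun u hu huv => ?_⟩
      rcases hs.chain u hu p (Finset.mem_filter.1 hp.1).1 with h | h
      · exact h
      · exact hp.2 (Finset.mem_filter.2 ⟨hu, huv⟩) h
    obtain ⟨p, ⟨hps, hpv⟩, hpmax⟩ := hpred
    push Not at hpv
    obtain ⟨i, hi⟩ := hpv
    -- The range of coordinate `i` over the cell is at most one, so the jump between `p` and `v`
    -- uses it up: on `s` this coordinate is a constant plus the indicator of the upper set of `v`.
    have hval : ∀ u ∈ s, u i = p i + if (∀ j, v j ≤ u j) then 1 else 0 := by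
      have hvp : v i = p i + 1 := by
        obtain ⟨a, ha⟩ := hs.integral v hv i
        obtain ⟨b, hb⟩ := hs.integral p hps i
        have h1 : (a : ℝ) ≤ b + 1 := ha ▸ hb ▸ hs.le_add_one v hv p hps i
        have h2 : (b : ℝ) < a := ha ▸ hb ▸ hi
        norm_cast at h1 h2
        have h3 : a = b + 1 := by omega
        rw [ha, hb, h3]
        push_cast
        rfl
      intro u hu
      split_ifs with h
      · have := hs.le_add_one u hu p hps i
        have := h i
        linarith
      · have h1 := hpmax u hu h i
        have := hs.le_add_one v hv u hu i
        linarith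
    have hsum : ∑ u ∈ s, c u * u i = 0 := by
      have := congrArg (fun y : EuclideanSpace ℝ ι => y i) h1
      simpa [WithLp.ofLp_sum] using this
    rw [Finset.sum_congr rfl fun u hu => by rw [hval u hu, mul_add]] at hsum
    rw [Finset.sum_add_distrib, ← Finset.sum_mul, h0, zero_mul, zero_add] at hsum
    simpa [Finset.sum_filter] using hsum
  by_contra! hcon
  obtain ⟨v₀, hv₀, hc₀⟩ := hcon
  obtain ⟨v, hv⟩ := Finset.exists_maximalFor (fun u : EuclideanSpace ℝ ι => (fun i => u i))
    (s.filter fun u => c u ≠ 0) ⟨v₀, Finset.mem_filter.2 ⟨hv₀, hc₀⟩⟩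
  obtain ⟨hvs, hcv⟩ := Finset.mem_filter.1 hv.1
  refine hcv ?_
  rw [← upper v hvs]
  symm
  rw [Finset.sum_filter, Finset.sum_eq_single v]
  · simp
  · intro u hu huv
    split_ifs with h
    · by_contra hcu
      have := hv.2 (Finset.mem_filter.2 ⟨hu, hcu⟩) h
      exact huv (PiLp.ext fun i => le_antisymm (this i) (h i))
    · rfl
  · exact fun h => absurd hvs h

/-- The right `θ` is the total weight of the vertices strictly below `w`. Thus a point determines
the vertices that carry it, whichever cell it was written in. -/
theorem IsKuhnCell.mem_floorPoint {s : Finset (EuclideanSpace ℝ ι)} (hs : IsKuhnCell s)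
    {c : EuclideanSpace ℝ ι → ℝ} (hc : ∀ v ∈ s, 0 < c v) (hc1 : ∑ v ∈ s, c v = 1)
    {w : EuclideanSpace ℝ ι} (hw : w ∈ s) :
    w ∈ floorPoint (∑ v ∈ s, c v • v) '' Set.Ico 0 1 := by
  classical
  set P : EuclideanSpace ℝ ι → Prop := fun u => u ≠ w ∧ ∀ i, u i ≤ w i with hP
  have hwP : ¬ P w := fun h => h.1 rfl
  have hc0 : ∀ v ∈ s, 0 ≤ c v := fun v hv => (hc v hv).le
  have hlt : ∑ u ∈ s, (if P u then c u else 0) ≤ 1 - c w := by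
    rw [← hc1, ← Finset.add_sum_erase s c hw, ← Finset.add_sum_erase s _ hw, if_neg hwP]
    have : ∑ u ∈ s.erase w, (if P u then c u else 0) ≤ ∑ u ∈ s.erase w, c u :=
      Finset.sum_le_sum fun u hu => by
        split_ifs
        · exact le_rfl
        · exact hc0 u (Finset.mem_of_mem_erase hu)
    linarith
  refine ⟨∑ u ∈ s, if P u then c u else 0, ⟨Finset.sum_nonneg fun u hu => ?_, ?_⟩, ?_⟩
  · split_ifs
    · exact hc0 u hu
    · exact le_rfl
  · linarith [hc w hw]
  ext i
  rw [floorPoint_apply]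
  obtain ⟨k, hk⟩ := hs.integral w hw i
  have hx : (∑ v ∈ s, c v • v) i + (∑ u ∈ s, if P u then c u else 0)
      = w i + ∑ u ∈ s, c u * (u i - w i + if P u then 1 else 0) := by
    have : ∑ u ∈ s, c u * (u i - w i + if P u then 1 else 0)
        = ∑ u ∈ s, c u * u i - (∑ u ∈ s, c u) * w i + ∑ u ∈ s, if P u then c u else 0 := by
      rw [Finset.sum_mul, ← Finset.sum_sub_distrib, ← Finset.sum_add_distrib]
      refine Finset.sum_congr rfl fun u _ => ?_
      split_ifs <;> ring
    rw [this, hc1]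
    simp only [WithLp.ofLp_sum, WithLp.ofLp_smul, Finset.sum_apply, Pi.smul_apply, smul_eq_mul]
    ring
  rw [hx, hk, add_comm, Int.floor_add_intCast, Int.cast_inj, add_eq_right,
    Int.floor_eq_zero_iff, ← hk]
  -- The remainder after subtracting `w i` is an average of numbers in `[0, 1]`, one of which, at `u
  -- = w`, is `0` with positive weight; so it lies in `[0, 1)`.
  have hterm : ∀ u ∈ s, 0 ≤ u i - w i + (if P u then (1 : ℝ) else 0) ∧
      u i - w i + (if P u then (1 : ℝ) else 0) ≤ 1 := by
    intro u hu
    have h1 := hs.le_add_one u hu w hw i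
    have h2 := hs.le_add_one w hw u hu i
    split_ifs with h
    · have := h.2 i
      constructor <;> linarith
    · have : w i ≤ u i := by
        rcases hs.chain u hu w hw with h' | h'
        · by_cases he : u = w
          · rw [he]
          · exact absurd ⟨he, h'⟩ h
        · exact h' i
      constructor <;> linarith
  refine ⟨Finset.sum_nonneg fun u hu => mul_nonneg (hc0 u hu) (hterm u hu).1, ?_⟩
  refine (Finset.sum_lt_sum (g := c) (fun u hu => ?_) ⟨w, hw, ?_⟩).trans_eq hc1
  · simpa using mul_le_mul_of_nonneg_left (hterm u hu).2 (hc0 u hu)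
  · simpa [hwP] using hc w hw

/-- Both supports of a common point consist of its floor points, so their union is again a cell, and
uniqueness of barycentric coordinates there identifies the supports. -/
theorem IsKuhnCell.inter_subset_convexHull {s t : Finset (EuclideanSpace ℝ ι)}
    (hs : IsKuhnCell s) (ht : IsKuhnCell t) :
    convexHull ℝ (s : Set (EuclideanSpace ℝ ι)) ∩ convexHull ℝ (t : Set (EuclideanSpace ℝ ι)) ⊆
      convexHull ℝ (s ∩ t : Set (EuclideanSpace ℝ ι)) := by
  classical
  rintro x ⟨hxs, hxt⟩
  obtain ⟨s', hs', c, hc, hc1, rfl⟩ := exists_pos_weights hxs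
  obtain ⟨t', ht', d, hd, hd1, hx⟩ := exists_pos_weights hxt
  have hcell : IsKuhnCell (s' ∪ t') := by
    refine isKuhnCell_of_subset_floorPoint (x := ∑ v ∈ s', c v • v) ?_
    rw [Finset.coe_union]
    refine Set.union_subset (fun w hw => (hs.mono hs').mem_floorPoint hc hc1 hw) fun w hw => ?_
    rw [← hx]
    exact (ht.mono ht').mem_floorPoint hd hd1 hw
  have hsub : s' ⊆ t' := by
    intro v hv
    by_contra hvt
    have := hcell.indep.eq_of_sum_eq (w := fun v => if v ∈ s' then c v else 0)
      (w' := fun v => if v ∈ t' then d v else 0) (v := v) ?_ ?_ (Finset.mem_union_left _ hv)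
    · simp only [hv, hvt, if_true, if_false] at this
      exact (hc v hv).ne' this
    · rw [← Finset.sum_filter, ← Finset.sum_filter, Finset.filter_mem_eq_inter,
        Finset.filter_mem_eq_inter, Finset.union_inter_cancel_left,
        Finset.union_inter_cancel_right, hc1, hd1]
    · simp only [ite_smul, zero_smul]
      rw [← Finset.sum_filter, ← Finset.sum_filter, Finset.filter_mem_eq_inter,
        Finset.filter_mem_eq_inter, Finset.union_inter_cancel_left,
        Finset.union_inter_cancel_right, hx]
  refine convexHull_mono (s := (s' : Set (EuclideanSpace ℝ ι)))
    (Set.subset_inter (fun v hv => hs' hv) fun v hv => ht' (hsub hv)) ?_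
  exact Finset.mem_convexHull'.2 ⟨c, fun v hv => (hc v hv).le, hc1, rfl⟩

variable [Fintype ι]

theorem finite_floorPoint (x : EuclideanSpace ℝ ι) :
    (floorPoint x '' Set.Ico 0 1).Finite := by
  classical
  refine ((Set.finite_Icc (fun i => ⌊x i⌋) (fun i => ⌊x i + 1⌋)).image
    fun k : ι → ℤ => (WithLp.toLp 2 fun i => (k i : ℝ) : EuclideanSpace ℝ ι)).subset ?_
  rintro _ ⟨θ, hθ, rfl⟩
  exact ⟨fun i => ⌊x i + θ⌋, ⟨fun i => Int.floor_le_floor (by linarith [hθ.1]),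
    fun i => Int.floor_le_floor (by linarith [hθ.2])⟩, rfl⟩

open MeasureTheory in
-- The floor exceeds `⌊a⌋` by one exactly on an interval of length `Int.fract a`.
theorem integral_floor_add (a : ℝ) : ∫ θ in Set.Ico (0 : ℝ) 1, (⌊a + θ⌋ : ℝ) = a := by
  have hfr := Int.fract_nonneg a
  have hfr1 := Int.fract_lt_one a
  have h : ∀ θ ∈ Set.Ico (0 : ℝ) 1, (⌊a + θ⌋ : ℝ)
      = ⌊a⌋ + (Set.Ico (1 - Int.fract a) 1).indicator (fun _ => (1 : ℝ)) θ := by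
    intro θ hθ
    have ha := Int.floor_add_fract a
    by_cases hθ' : 1 - Int.fract a ≤ θ
    · rw [Set.indicator_of_mem (by exact ⟨hθ', hθ.2⟩)]
      have : ⌊a + θ⌋ = ⌊a⌋ + 1 := by
        rw [Int.floor_eq_iff]
        push_cast
        constructor <;> linarith [hθ.2]
      rw [this]; push_cast; ring
    · rw [Set.indicator_of_notMem (fun h => hθ' h.1)]
      have : ⌊a + θ⌋ = ⌊a⌋ := by
        rw [Int.floor_eq_iff]
        constructor <;> linarith [hθ.1]
      rw [this]; ring
  rw [setIntegral_congr_fun measurableSet_Ico h, integral_add (by simp) ]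
  · rw [integral_indicator measurableSet_Ico, Measure.restrict_restrict measurableSet_Ico]
    have : Set.Ico (1 - Int.fract a) 1 ∩ Set.Ico 0 1 = Set.Ico (1 - Int.fract a) 1 :=
      Set.inter_eq_left.2 fun x hx => ⟨by linarith [hx.1], hx.2⟩
    rw [this]
    simp [Real.volume_real_Ico, hfr, Int.floor_add_fract]
  · exact (integrable_const _).indicator measurableSet_Ico

open MeasureTheory in
-- The point is the mean of its floor points over `θ`, and a mean stays in a closed convex set.
-- Hence the cells cover `ℝ^ι`.
theorem mem_convexHull_floorPoint (x : EuclideanSpace ℝ ι) :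
    x ∈ convexHull ℝ (floorPoint x '' Set.Ico 0 1) := by
  have hmeas : Measurable (floorPoint x) := by
    refine (WithLp.measurable_toLp 2 _).comp (measurable_pi_lambda _ fun i => ?_)
    exact measurable_from_top.comp (Int.measurable_floor.comp (measurable_const.add measurable_id))
  have : IsProbabilityMeasure (volume.restrict (Set.Ico (0 : ℝ) 1)) := ⟨by simp⟩
  have hcpt := (finite_floorPoint x).isCompact_convexHull ℝ
  have hmem : ∀ᵐ θ ∂volume.restrict (Set.Ico (0 : ℝ) 1),
      floorPoint x θ ∈ convexHull ℝ (floorPoint x '' Set.Ico 0 1) :=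
    (ae_restrict_mem measurableSet_Ico).mono fun θ hθ =>
      subset_convexHull ℝ _ (Set.mem_image_of_mem _ hθ)
  have hint : Integrable (floorPoint x) (volume.restrict (Set.Ico (0 : ℝ) 1)) := by
    obtain ⟨C, hC⟩ := hcpt.isBounded.exists_norm_le
    exact Integrable.of_bound hmeas.aestronglyMeasurable C (hmem.mono fun θ hθ => hC _ hθ)
  have := (convex_convexHull ℝ _).integral_mem hcpt.isClosed hmem hint
  convert this
  ext i
  have h := (EuclideanSpace.proj (𝕜 := ℝ) i : EuclideanSpace ℝ ι →L[ℝ] ℝ).integral_comp_comm hint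
  exact (integral_floor_add (x i)).symm.trans h

end Kuhn

/-! ### Kuhn's triangulation of the far faces of a cube, and its symmetry. -/

section KuhnComplex

variable {ι : Type*}

theorem apply_mem_Icc_of_mem_convexHull {s : Set (EuclideanSpace ℝ ι)} {i : ι} {a b : ℝ}
    (h : ∀ v ∈ s, v i ∈ Set.Icc a b) {x : EuclideanSpace ℝ ι} (hx : x ∈ convexHull ℝ s) :
    x i ∈ Set.Icc a b :=
  convexHull_min (t := (EuclideanSpace.proj i : EuclideanSpace ℝ ι →L[ℝ] ℝ) ⁻¹' Set.Icc a b) h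
    ((convex_Icc a b).linear_preimage
      (EuclideanSpace.proj i : EuclideanSpace ℝ ι →L[ℝ] ℝ).toLinearMap) hx

/-- The part of Kuhn's triangulation which covers those points of the cube `[0, N]^ι` which have
some coordinate equal to `N` and whose support lies in a member of `S`. -/
def kuhnComplex (S : Set (Finset ι)) (N : ℕ) :
    Geometry.SimplicialComplex ℝ (EuclideanSpace ℝ ι) where
  faces := {s | s.Nonempty ∧ IsKuhnCell s ∧ (∀ v ∈ s, ∀ i, 0 ≤ v i ∧ v i ≤ N) ∧
    (∃ i, ∀ v ∈ s, v i = N) ∧ ∃ σ ∈ S, ∀ v ∈ s, ∀ i, v i ≠ 0 → i ∈ σ}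
  isRelLowerSet_faces := by
    rintro s ⟨hne, hcell, hbd, ⟨i, hi⟩, σ, hσ, hs⟩
    exact ⟨hne, fun t hts ht => ⟨ht, hcell.mono hts, fun v hv => hbd v (hts hv),
      ⟨i, fun v hv => hi v (hts hv)⟩, σ, hσ, fun v hv => hs v (hts hv)⟩⟩
  indep hs := hs.2.1.indep
  inter_subset_convexHull hs ht := hs.2.1.inter_subset_convexHull ht.2.1

variable {S : Set (Finset ι)} {N : ℕ}

theorem abs_sub_le_one_of_mem_face {s : Finset (EuclideanSpace ℝ ι)}
    (hs : s ∈ (kuhnComplex S N).faces) {x y : EuclideanSpace ℝ ι}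
    (hx : x ∈ convexHull ℝ (s : Set (EuclideanSpace ℝ ι)))
    (hy : y ∈ convexHull ℝ (s : Set (EuclideanSpace ℝ ι))) (i : ι) : |x i - y i| ≤ 1 := by
  have hcell := hs.2.1
  have h1 : ∀ u ∈ s, ∀ z ∈ convexHull ℝ (s : Set (EuclideanSpace ℝ ι)),
      z i ∈ Set.Icc (u i - 1) (u i + 1) := fun u hu z hz =>
    apply_mem_Icc_of_mem_convexHull (fun v hv => ⟨by linarith [hcell.le_add_one u hu v hv i],
      hcell.le_add_one v hv u hu i⟩) hz
  have h2 := apply_mem_Icc_of_mem_convexHull (i := i) (a := y i - 1) (b := y i + 1)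
    (fun u hu => by
      have := h1 u hu y hy
      exact ⟨by linarith [this.2], by linarith [this.1]⟩) hx
  rw [abs_le]
  constructor <;> linarith [h2.1, h2.2]

variable [Fintype ι]

/-- Coordinates equal to `0` or `N` are integers, so adding `θ < 1` and rounding down leaves them
alone; the floor points of `x` inherit all the constraints on `x`. -/
theorem mem_space_kuhnComplex {x : EuclideanSpace ℝ ι} :
    x ∈ (kuhnComplex S N).space ↔ (∀ i, 0 ≤ x i ∧ x i ≤ N) ∧ (∃ i, x i = N) ∧
      ∃ σ ∈ S, ∀ i, x i ≠ 0 → i ∈ σ := by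
  rw [Geometry.SimplicialComplex.mem_space_iff]
  constructor
  · rintro ⟨s, ⟨-, -, hbd, ⟨i, hi⟩, σ, hσ, hs⟩, hx⟩
    refine ⟨fun j => apply_mem_Icc_of_mem_convexHull (fun v hv => hbd v hv j) hx, ⟨i, ?_⟩, σ, hσ,
      fun j => ?_⟩
    · have := apply_mem_Icc_of_mem_convexHull (i := i) (a := N) (b := N)
        (fun v hv => by rw [hi v hv]; simp) hx
      exact le_antisymm this.2 this.1
    · contrapose!
      intro hj
      have := apply_mem_Icc_of_mem_convexHull (i := j) (a := 0) (b := 0)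
        (fun v hv => by
          have : v j = 0 := by
            by_contra h
            exact hj (hs v hv j h)
          rw [this]; simp) hx
      exact le_antisymm this.2 this.1
  · rintro ⟨hbd, ⟨i, hi⟩, σ, hσ, hs⟩
    have hx := mem_convexHull_floorPoint x
    have hfin := finite_floorPoint x
    refine ⟨hfin.toFinset, ⟨?_, isKuhnCell_of_subset_floorPoint (x := x) (by simp), ?_, ⟨i, ?_⟩, σ,
      hσ, ?_⟩, by simpa using hx⟩
    · exact ⟨floorPoint x 0, hfin.mem_toFinset.2 ⟨0, by simp, rfl⟩⟩
    · intro v hv j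
      obtain ⟨θ, hθ, rfl⟩ := hfin.mem_toFinset.1 hv
      rw [floorPoint_apply]
      constructor
      · exact Int.cast_nonneg (R := ℝ) (Int.floor_nonneg.2 (add_nonneg (hbd j).1 hθ.1))
      · have : ⌊x j + θ⌋ < (N : ℤ) + 1 := by
          rw [Int.floor_lt]; push_cast; linarith [(hbd j).2, hθ.2]
        exact (Int.cast_le (R := ℝ)).2 (Int.lt_add_one_iff.1 this)
    · intro v hv
      obtain ⟨θ, hθ, rfl⟩ := hfin.mem_toFinset.1 hv
      have : ⌊x i + θ⌋ = (N : ℤ) := by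
        rw [Int.floor_eq_iff, hi]; push_cast; constructor <;> linarith [hθ.1, hθ.2]
      rw [floorPoint_apply, this]; simp
    · intro v hv j hj
      obtain ⟨θ, hθ, rfl⟩ := hfin.mem_toFinset.1 hv
      refine hs j fun h0 => hj ?_
      rw [floorPoint_apply, h0, zero_add, Int.floor_eq_zero_iff.2 hθ, Int.cast_zero]

theorem finite_faces_kuhnComplex : (kuhnComplex S N).faces.Finite := by
  classical
  set P : Finset (EuclideanSpace ℝ ι) := (Finset.Icc (0 : ι → ℤ) fun _ => (N : ℤ)).image
    fun k => WithLp.toLp 2 fun i => (k i : ℝ)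
  refine (Finset.finite_toSet P.powerset).subset fun s hs => ?_
  rw [Finset.mem_coe, Finset.mem_powerset]
  intro v hv
  obtain ⟨-, hcell, hbd, -⟩ := hs
  choose k hk using hcell.integral v hv
  refine Finset.mem_image.2 ⟨k, Finset.mem_Icc.2 ⟨fun i => ?_, fun i => ?_⟩, ?_⟩
  · have := (hbd v hv i).1
    rw [hk] at this
    exact (Int.cast_nonneg_iff (R := ℝ)).1 this
  · have := (hbd v hv i).2
    rw [hk] at this
    exact (Int.cast_le (R := ℝ)).1 this
  · ext i
    exact (hk i).symm

/-- The permutation of coordinates of `ℝ^ι` induced by a permutation of `ι`. -/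
noncomputable def permCoord (a : Equiv.Perm ι) : EuclideanSpace ℝ ι ≃ₗᵢ[ℝ] EuclideanSpace ℝ ι :=
  LinearIsometryEquiv.piLpCongrLeft 2 ℝ ℝ a

@[simp] theorem permCoord_apply (a : Equiv.Perm ι) (y : EuclideanSpace ℝ ι) (i : ι) :
    permCoord a y i = y (a.symm i) := by
  simp [permCoord, Equiv.piCongrLeft', LinearIsometryEquiv.piLpCongrLeft_apply]

/-- The permutation of coordinates as an embedding. -/
noncomputable def permCoordEmbedding (a : Equiv.Perm ι) :
    EuclideanSpace ℝ ι ↪ EuclideanSpace ℝ ι :=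
  ⟨permCoord a, (permCoord a).injective⟩

@[simp] theorem coe_permCoordEmbedding (a : Equiv.Perm ι) :
    ⇑(permCoordEmbedding a) = permCoord a := rfl

theorem map_permCoord_mem_faces {a : Equiv.Perm ι} (ha : ∀ σ ∈ S, σ.map a.toEmbedding ∈ S)
    {s : Finset (EuclideanSpace ℝ ι)} (hs : s ∈ (kuhnComplex S N).faces) :
    s.map (permCoordEmbedding a) ∈ (kuhnComplex S N).faces := by
  obtain ⟨hne, ⟨hint, hch, hle⟩, hbd, ⟨i, hi⟩, σ, hσ, hsσ⟩ := hs
  refine ⟨hne.map, ⟨?_, ?_, ?_⟩, ?_, ⟨a i, ?_⟩, σ.map a.toEmbedding, ha σ hσ, ?_⟩ <;>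
    simp only [Finset.forall_mem_map, coe_permCoordEmbedding,
      permCoord_apply]
  · exact fun v hv j => hint v hv _
  · exact fun u hu v hv => (hch u hu v hv).imp (fun h j => h _) fun h j => h _
  · exact fun u hu v hv j => hle u hu v hv _
  · exact fun v hv j => hbd v hv _
  · simpa using hi
  · exact fun v hv j hj => Finset.mem_map.2 ⟨a.symm j, hsσ v hv _ hj, by simp⟩

end KuhnComplex

/-! ### Uniqueness of barycentric coordinates in a complex. -/

theorem Finset.sum_map_extend {ι E W : Type*} [Fintype ι] {p : ι ↪ E} [AddCommMonoid W] {σ : Finset ι} {c : ι → ℝ}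
    (hc : ∀ i, c i ≠ 0 → i ∈ σ) (g : ℝ → E → W) (hg : ∀ v, g 0 v = 0) :
    ∑ v ∈ σ.map p, g (Function.extend p c 0 v) v = ∑ i, g (c i) (p i) := by
  rw [Finset.sum_map]
  simp only [p.injective.extend_apply]
  refine Finset.sum_subset (Finset.subset_univ _) fun i _ hi => ?_
  have : c i = 0 := by
    by_contra h
    exact hi (hc i h)
  rw [this, hg]

namespace Geometry.SimplicialComplex

variable {E : Type*} [NormedAddCommGroup E] [NormedSpace ℝ E]
  (K : Geometry.SimplicialComplex ℝ E)

theorem isCompact_space (hK : K.faces.Finite) : IsCompact K.space :=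
  hK.isCompact_biUnion fun s _ => s.finite_toSet.isCompact_convexHull ℝ

variable {K}

/-- The common point also has weights supported on `s ∩ t`; affine independence of each face
compares these with `w` and with `w'`. -/
theorem weights_unique {s t : Finset E} (hs : s ∈ K.faces) (ht : t ∈ K.faces) {w w' : E → ℝ}
    (hw : ∀ v, 0 ≤ w v) (hw' : ∀ v, 0 ≤ w' v) (hws : ∀ v ∉ s, w v = 0) (hwt : ∀ v ∉ t, w' v = 0)
    (h1 : ∑ v ∈ s, w v = 1) (h1' : ∑ v ∈ t, w' v = 1)
    (h : ∑ v ∈ s, w v • v = ∑ v ∈ t, w' v • v) : w = w' := by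
  classical
  have hx := K.inter_subset_convexHull hs ht
    ⟨Finset.mem_convexHull'.2 ⟨w, fun v _ => hw v, h1, rfl⟩,
      Finset.mem_convexHull'.2 ⟨w', fun v _ => hw' v, h1', h.symm⟩⟩
  rw [← Finset.coe_inter] at hx
  obtain ⟨μ, -, hμ1, hμ⟩ := Finset.mem_convexHull'.1 hx
  set ν : E → ℝ := fun v => if v ∈ s ∩ t then μ v else 0 with hν
  have sum_ν : ∀ r : Finset E, s ∩ t ⊆ r → ∑ v ∈ r, ν v = 1 ∧
      ∑ v ∈ r, ν v • v = ∑ v ∈ s, w v • v := by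
    intro r hr
    simp only [hν, ite_smul, zero_smul]
    rw [← Finset.sum_filter, ← Finset.sum_filter, Finset.filter_mem_eq_inter,
      Finset.inter_eq_right.2 hr]
    exact ⟨hμ1, hμ⟩
  obtain ⟨hs1, hs2⟩ := sum_ν s Finset.inter_subset_left
  obtain ⟨ht1, ht2⟩ := sum_ν t Finset.inter_subset_right
  have e : ∀ v, w v = ν v := fun v => by
    by_cases hv : v ∈ s
    · exact (K.indep hs).eq_of_sum_eq (h1.trans hs1.symm) hs2.symm hv
    · rw [hws v hv, hν]; simp [hv]
  have e' : ∀ v, w' v = ν v := fun v => by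
    by_cases hv : v ∈ t
    · exact (K.indep ht).eq_of_sum_eq (h1'.trans ht1.symm) (h.symm.trans ht2.symm) hv
    · rw [hwt v hv, hν]; simp [hv]
  exact funext fun v => (e v).trans (e' v).symm

/-- The abstract simplicial complex obtained from `K` by indexing its vertices. -/
def indexFaces {ι : Type*} (K : Geometry.SimplicialComplex ℝ E) (p : ι ↪ E) : Set (Finset ι) :=
  {σ | σ.map p ∈ K.faces}

variable {ι : Type*} [Fintype ι] {p : ι ↪ E}

theorem weights_unique_index {σ τ : Finset ι} (hσ : σ ∈ K.indexFaces p)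
    (hτ : τ ∈ K.indexFaces p) {c c' : ι → ℝ} (hc : ∀ i, 0 ≤ c i) (hc' : ∀ i, 0 ≤ c' i)
    (hcσ : ∀ i, c i ≠ 0 → i ∈ σ) (hcτ : ∀ i, c' i ≠ 0 → i ∈ τ) (h1 : ∑ i, c i = 1)
    (h1' : ∑ i, c' i = 1) (h : ∑ i, c i • p i = ∑ i, c' i • p i) : c = c' := by
  have nonneg : ∀ {c : ι → ℝ}, (∀ i, 0 ≤ c i) → ∀ v, 0 ≤ Function.extend p c 0 v := by
    intro c hc v
    by_cases hv : ∃ i, p i = v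
    · obtain ⟨i, rfl⟩ := hv
      rw [p.injective.extend_apply]; exact hc i
    · rw [Function.extend_apply' _ _ _ hv]; rfl
  have supp : ∀ {c : ι → ℝ} {σ : Finset ι}, (∀ i, c i ≠ 0 → i ∈ σ) →
      ∀ v ∉ σ.map p, Function.extend p c 0 v = 0 := by
    intro c σ hc v hv
    by_cases hv' : ∃ i, p i = v
    · obtain ⟨i, rfl⟩ := hv'
      rw [p.injective.extend_apply]
      by_contra h
      exact hv (Finset.mem_map_of_mem _ (hc i h))
    · rw [Function.extend_apply' _ _ _ hv']; rfl
  have := weights_unique (w := Function.extend p c 0) (w' := Function.extend p c' 0) hσ hτ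
    (nonneg hc) (nonneg hc') (supp hcσ) (supp hcτ)
    ((Finset.sum_map_extend hcσ (fun r _ => r) fun _ => rfl).trans h1)
    ((Finset.sum_map_extend hcτ (fun r _ => r) fun _ => rfl).trans h1')
    ((Finset.sum_map_extend hcσ (fun r v => r • v) fun v => zero_smul _ v).trans
      (h.trans (Finset.sum_map_extend hcτ (fun r v => r • v) fun v => zero_smul _ v).symm))
  funext i
  simpa [p.injective.extend_apply] using congrFun this (p i)

end Geometry.SimplicialComplex

/-! ### Radial homeomorphism from the cube model to the polyhedron. -/

section RadialMap

open Geometry.SimplicialComplex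

variable {E : Type*} [NormedAddCommGroup E] [NormedSpace ℝ E]
  {K : Geometry.SimplicialComplex ℝ E} {ι : Type*} [Fintype ι] {p : ι ↪ E} {N : ℕ}

/-- The map which sends a point with nonnegative coordinates to the combination of the points `p i`
with proportional coefficients. -/
noncomputable def radialMap (p : ι → E) (y : EuclideanSpace ℝ ι) : E :=
  ∑ i, ((∑ j, y j)⁻¹ * y i) • p i

theorem le_sum_of_mem_space {S : Set (Finset ι)} {y : EuclideanSpace ℝ ι}
    (hy : y ∈ (kuhnComplex S N).space) : (N : ℝ) ≤ ∑ i, y i := by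
  obtain ⟨hbd, ⟨i, hi⟩, -⟩ := mem_space_kuhnComplex.1 hy
  rw [← hi]
  exact Finset.single_le_sum (f := fun i => y i) (fun j _ => (hbd j).1) (Finset.mem_univ i)

theorem sum_normalized {y : EuclideanSpace ℝ ι} (h : 0 < ∑ i, y i) :
    ∑ i, (∑ j, y j)⁻¹ * y i = 1 := by
  rw [← Finset.mul_sum, inv_mul_cancel₀ h.ne']

theorem radialMap_mem_space {y : EuclideanSpace ℝ ι} (hN : 0 < N)
    (hy : y ∈ (kuhnComplex (K.indexFaces p) N).space) : radialMap p y ∈ K.space := by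
  have hpos : 0 < ∑ i, y i := lt_of_lt_of_le (by exact_mod_cast hN) (le_sum_of_mem_space hy)
  obtain ⟨hbd, -, σ, hσ, hs⟩ := mem_space_kuhnComplex.1 hy
  refine mem_space_iff.2 ⟨σ.map p, hσ, ?_⟩
  have hzero : ∀ i ∉ σ, (∑ j, y j)⁻¹ * y i = 0 := fun i hi => by
    have : y i = 0 := by
      by_contra h
      exact hi (hs i h)
    rw [this, mul_zero]
  have h1 : ∑ i ∈ σ, (∑ j, y j)⁻¹ * y i = 1 := by
    rw [← sum_normalized hpos]
    exact Finset.sum_subset (Finset.subset_univ _) fun i _ hi => hzero i hi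
  have h2 : radialMap p y = ∑ i ∈ σ, ((∑ j, y j)⁻¹ * y i) • p i := by
    symm
    exact Finset.sum_subset (Finset.subset_univ _) fun i _ hi => by rw [hzero i hi, zero_smul]
  rw [h2]
  exact (convex_convexHull ℝ _).sum_mem
    (fun i _ => mul_nonneg (inv_nonneg.2 hpos.le) (hbd i).1) h1
    fun i hi => subset_convexHull ℝ _ (by simpa using hi)

/-- Equal images have equal normalized coordinates, so `y` and `z` are proportional; both have
largest coordinate `N`, so the factor is one. -/
theorem radialMap_injOn (hN : 0 < N) :
    Set.InjOn (radialMap p) (kuhnComplex (K.indexFaces p) N).space := by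
  have hN' : (0 : ℝ) < N := by exact_mod_cast hN
  intro y hy z hz h
  have hposy : 0 < ∑ i, y i := lt_of_lt_of_le hN' (le_sum_of_mem_space hy)
  have hposz : 0 < ∑ i, z i := lt_of_lt_of_le hN' (le_sum_of_mem_space hz)
  obtain ⟨hby, ⟨i, hi⟩, σ, hσ, hsσ⟩ := mem_space_kuhnComplex.1 hy
  obtain ⟨hbz, ⟨k, hk⟩, τ, hτ, hsτ⟩ := mem_space_kuhnComplex.1 hz
  have key := weights_unique_index hσ hτ (c := fun i => (∑ j, y j)⁻¹ * y i)
    (c' := fun i => (∑ j, z j)⁻¹ * z i)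
    (fun i => mul_nonneg (inv_nonneg.2 hposy.le) (hby i).1)
    (fun i => mul_nonneg (inv_nonneg.2 hposz.le) (hbz i).1)
    (fun i hi => hsσ i (right_ne_zero_of_mul hi)) (fun i hi => hsτ i (right_ne_zero_of_mul hi))
    (sum_normalized hposy) (sum_normalized hposz) h
  have key' : ∀ i, y i * ∑ j, z j = z i * ∑ j, y j := fun i => by
    have := congrFun key i
    simp only at this
    field_simp at this
    rw [this, mul_comm]
  have hsum : ∑ j, y j = ∑ j, z j := by
    apply le_antisymm
    · have h1 := key' k
      rw [hk] at h1
      have h2 := mul_le_mul_of_nonneg_right (hby k).2 hposz.le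
      rw [h1] at h2
      exact le_of_mul_le_mul_left h2 hN'
    · have h1 := key' i
      rw [hi] at h1
      have h2 := mul_le_mul_of_nonneg_right (hbz i).2 hposy.le
      rw [← h1] at h2
      exact le_of_mul_le_mul_left h2 hN'
  ext j
  have := key' j
  rw [hsum] at this
  exact mul_right_cancel₀ hposz.ne' this

/-- The preimage is the vector of barycentric coordinates, rescaled to have maximum `N`. -/
theorem exists_radialMap_eq (hp : K.vertices ⊆ Set.range p) (hN : 0 < N) {x : E}
    (hx : x ∈ K.space) : ∃ y ∈ (kuhnComplex (K.indexFaces p) N).space, radialMap p y = x := by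
  classical
  have hN' : (0 : ℝ) < N := by exact_mod_cast hN
  obtain ⟨s, hs, hx⟩ := mem_space_iff.1 hx
  obtain ⟨w, hw0, hw1, hwx⟩ := Finset.mem_convexHull'.1 hx
  set σ : Finset ι := s.preimage p p.injective.injOn with hσ
  have hσs : σ.map p = s := by
    rw [hσ, Finset.map_eq_image, Finset.image_preimage]
    refine Finset.filter_true_of_mem fun v hv => hp ?_
    exact K.down_closed hs (Finset.singleton_subset_iff.2 hv) (Finset.singleton_nonempty v)
  set c : ι → ℝ := fun i => if i ∈ σ then w (p i) else 0 with hc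
  have hc0 : ∀ i, 0 ≤ c i := fun i => by
    simp only [hc]
    split_ifs with h
    · exact hw0 _ (Finset.mem_preimage.1 h)
    · exact le_rfl
  have hc1 : ∑ i, c i = 1 := by
    rw [← hw1, ← hσs, Finset.sum_map]
    simp [hc]
  have hcx : ∑ i, c i • p i = x := by
    rw [← hwx, ← hσs, Finset.sum_map]
    simp [hc, ite_smul]
  have hne : (Finset.univ : Finset ι).Nonempty := by
    rw [Finset.nonempty_iff_ne_empty]
    intro h
    rw [h] at hc1
    simp at hc1
  obtain ⟨k, -, hk⟩ := Finset.exists_max_image Finset.univ c hne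
  have hkpos : 0 < c k := by
    by_contra h
    have : ∑ i, c i ≤ 0 := Finset.sum_nonpos fun i hi => (hk i hi).trans (not_lt.1 h)
    linarith
  refine ⟨WithLp.toLp 2 fun i => N / c k * c i, mem_space_kuhnComplex.2 ⟨fun i => ⟨?_, ?_⟩,
    ⟨k, ?_⟩, σ, ?_, fun i hi => ?_⟩, ?_⟩
  · exact mul_nonneg (div_nonneg hN'.le hkpos.le) (hc0 i)
  · show N / c k * c i ≤ N
    rw [div_mul_eq_mul_div, div_le_iff₀ hkpos]
    exact mul_le_mul_of_nonneg_left (hk i (Finset.mem_univ i)) hN'.le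
  · show N / c k * c k = N
    field_simp
  · show σ.map p ∈ K.faces
    rwa [hσs]
  · by_contra h
    refine hi ?_
    show N / c k * c i = 0
    simp [hc, h]
  · rw [← hcx, radialMap]
    refine Finset.sum_congr rfl fun i _ => ?_
    congr 1
    show (∑ j, N / c k * c j)⁻¹ * (N / c k * c i) = c i
    rw [← Finset.mul_sum, hc1]
    field_simp

theorem continuousOn_radialMap (hN : 0 < N) :
    ContinuousOn (radialMap p) (kuhnComplex (K.indexFaces p) N).space := by
  unfold radialMap
  refine continuousOn_finsetSum _ fun i _ => ContinuousOn.smul (ContinuousOn.mul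
    (ContinuousOn.inv₀ ?_ fun y hy => ?_) ?_) continuousOn_const
  · fun_prop
  · exact (lt_of_lt_of_le (by exact_mod_cast hN) (le_sum_of_mem_space hy)).ne'
  · fun_prop

theorem dist_radialMap_le {S : Set (Finset ι)} (hN : 0 < N) {C : ℝ} (hC : ∀ i, ‖p i‖ ≤ C)
    {y z : EuclideanSpace ℝ ι} (hy : y ∈ (kuhnComplex S N).space)
    (hz : z ∈ (kuhnComplex S N).space) (h : ∀ i, |y i - z i| ≤ 1) :
    dist (radialMap p y) (radialMap p z) ≤ 2 * (Fintype.card ι * C) / N := by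
  have hN' : (0 : ℝ) < N := by exact_mod_cast hN
  have hyN := le_sum_of_mem_space hy
  have hposy : 0 < ∑ i, y i := hN'.trans_le hyN
  have hposz : 0 < ∑ i, z i := hN'.trans_le (le_sum_of_mem_space hz)
  obtain ⟨hbz, -⟩ := mem_space_kuhnComplex.1 hz
  have hC0 : 0 ≤ C := by
    obtain ⟨-, ⟨i, -⟩, -⟩ := mem_space_kuhnComplex.1 hy
    exact (norm_nonneg _).trans (hC i)
  -- With this form each of the two terms is at most `card ι * C`, and the factor in front is at
  -- most `1 / N`.
  have hrw : radialMap p y - radialMap p z = (∑ j, y j)⁻¹ •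
      (∑ i, (y i - z i) • p i - (∑ i, (y i - z i)) • radialMap p z) := by
    simp only [radialMap, Finset.smul_sum, ← Finset.sum_sub_distrib, smul_smul, ← sub_smul]
    refine Finset.sum_congr rfl fun i _ => ?_
    congr 1
    rw [Finset.sum_sub_distrib]
    field_simp
    ring
  have hnorm : ‖radialMap p z‖ ≤ C := by
    calc ‖radialMap p z‖ ≤ ∑ i, ((∑ j, z j)⁻¹ * z i) * C := by
          refine norm_sum_le_of_le _ fun i _ => ?_
          rw [norm_smul, Real.norm_of_nonneg (mul_nonneg (inv_nonneg.2 hposz.le) (hbz i).1)]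
          exact mul_le_mul_of_nonneg_left (hC i) (mul_nonneg (inv_nonneg.2 hposz.le) (hbz i).1)
      _ = C := by rw [← Finset.sum_mul, sum_normalized hposz, one_mul]
  have h1 : ‖∑ i, (y i - z i) • p i‖ ≤ Fintype.card ι * C := by
    refine (norm_sum_le_of_le (f := fun i => (y i - z i) • p i) (n := fun _ => C) _
      fun i _ => ?_).trans_eq (by simp)
    rw [norm_smul, Real.norm_eq_abs]
    exact (mul_le_mul (h i) (hC i) (norm_nonneg _) zero_le_one).trans_eq (one_mul C)
  have h2 : ‖(∑ i, (y i - z i)) • radialMap p z‖ ≤ Fintype.card ι * C := by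
    rw [norm_smul, Real.norm_eq_abs]
    refine mul_le_mul ?_ hnorm (norm_nonneg _) (Nat.cast_nonneg _)
    exact (Finset.abs_sum_le_sum_abs _ _).trans
      ((Finset.sum_le_sum fun i _ => h i).trans_eq (by simp))
  rw [dist_eq_norm, hrw, norm_smul, Real.norm_of_nonneg (inv_nonneg.2 hposy.le), div_eq_inv_mul]
  refine mul_le_mul (inv_anti₀ hN' hyN) ?_ (norm_nonneg _) (inv_nonneg.2 hN'.le)
  calc _ ≤ _ := norm_sub_le _ _
    _ ≤ _ := by linarith

theorem radialMap_permCoord (a : Equiv.Perm ι) (y : EuclideanSpace ℝ ι) :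
    radialMap p (permCoord a y) = ∑ i, ((∑ j, y j)⁻¹ * y i) • p (a i) := by
  simp only [radialMap, permCoord_apply]
  rw [Equiv.sum_comp a.symm fun j => y j, ← Equiv.sum_comp a]
  simp

/-- Kuhn's triangulation, transported to the polyhedron of `K`. -/
noncomputable def kuhnHomeo (hp : K.vertices ⊆ Set.range p) (hN : 0 < N) :
    (kuhnComplex (K.indexFaces p) N).space ≃ₜ K.space :=
  haveI : CompactSpace (kuhnComplex (K.indexFaces p) N).space :=
    isCompact_iff_compactSpace.1 (isCompact_space _ finite_faces_kuhnComplex)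
  Continuous.homeoOfEquivCompactToT2
    (f := Equiv.ofBijective (fun y => ⟨radialMap p y, radialMap_mem_space hN y.2⟩)
      ⟨fun y z h => Subtype.ext (radialMap_injOn hN y.2 z.2 (Subtype.ext_iff.1 h)), fun x =>
        let ⟨y, hy, h⟩ := exists_radialMap_eq hp hN x.2
        ⟨⟨y, hy⟩, Subtype.ext h⟩⟩)
    (Continuous.subtype_mk (continuousOn_iff_continuous_domRestrict.1 (continuousOn_radialMap hN)) _)

@[simp] theorem coe_kuhnHomeo_apply (hp : K.vertices ⊆ Set.range p) (hN : 0 < N)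
    (y : (kuhnComplex (K.indexFaces p) N).space) :
    (kuhnHomeo hp hN y : E) = radialMap p y := rfl

end RadialMap

/-! ### The involution as a permutation of coordinates; fine antipodal triangulations. -/

section SimplicialInvolution

open Geometry.SimplicialComplex

variable {E : Type*} [NormedAddCommGroup E] [NormedSpace ℝ E]
  {K : Geometry.SimplicialComplex ℝ E} {A : K.space → K.space}

theorem AffineMap.map_sum_smul {ι V W : Type*} [AddCommGroup V] [Module ℝ V] [AddCommGroup W]
    [Module ℝ W] (g : V →ᵃ[ℝ] W) (s : Finset ι) (c : ι → ℝ) (hc : ∑ i ∈ s, c i = 1) (p : ι → V) :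
    g (∑ i ∈ s, c i • p i) = ∑ i ∈ s, c i • g (p i) := by
  have h : ∀ x, g x = g.linear x + g 0 := fun x => congrFun g.decomp x
  rw [h, map_sum]
  simp only [map_smul, h (p _), smul_add, Finset.sum_add_distrib, ← Finset.sum_smul, hc, one_smul]

theorem IsSimplicialSelfMap.exists_perm {ι : Type*} (hA : IsSimplicialSelfMap K A)
    (hinv : Function.Involutive A) (p : ι ↪ E) (hp : Set.range p = K.vertices) :
    ∃ a : Equiv.Perm ι,
      (∀ σ ∈ K.indexFaces p, σ.map a.toEmbedding ∈ K.indexFaces p) ∧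
      ∀ σ ∈ K.indexFaces p, ∀ c : ι → ℝ, (∀ i, 0 ≤ c i) → ∑ i ∈ σ, c i = 1 →
        ∀ x : K.space, (x : E) = ∑ i ∈ σ, c i • p i → (A x : E) = ∑ i ∈ σ, c i • p (a i) := by
  classical
  have hpv : ∀ i, p i ∈ K.vertices := fun i => hp ▸ Set.mem_range_self i
  set P : ι → K.space := fun i => ⟨p i, vertices_subset_space (hpv i)⟩ with hP
  have hA' : ∀ i, ∃ j, p j = (A (P i) : E) := by
    intro i
    obtain ⟨g, hg, t, ht, hgt⟩ := hA {p i} (hpv i)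
    rw [Finset.coe_singleton, Set.image_singleton] at hgt
    have hAi : (A (P i) : E) = g (p i) := hg (P i) (by simp [hP])
    have : t = {g (p i)} := by
      rw [← Finset.coe_inj, hgt, Finset.coe_singleton]
    have hmem : (A (P i) : E) ∈ K.vertices := by
      rw [hAi, mem_vertices, ← this]; exact ht
    rwa [← hp] at hmem
  choose a ha using hA'
  have haP : ∀ i, P (a i) = A (P i) := fun i => Subtype.ext (ha i)
  -- The vertex map inherits involutivity from `A`, which makes it a permutation.
  have hainv : Function.Involutive a := fun i => by
    apply p.injective
    rw [ha, haP, hinv]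
  refine ⟨hainv.toPerm, fun σ hσ => ?_, fun σ hσ c hc0 hc1 x hx => ?_⟩
  · obtain ⟨g, hg, t, ht, hgt⟩ := hA _ hσ
    have : (σ.map hainv.toPerm.toEmbedding).map p = t := by
      rw [← Finset.coe_inj, hgt]
      simp only [Finset.coe_map, Set.image_image]
      refine Set.image_congr fun i hi => ?_
      rw [← hg (P i) (subset_convexHull ℝ _ (by simpa [hP] using hi))]
      exact ha i
    show _ ∈ K.faces
    rwa [this]
  · obtain ⟨g, hg, -⟩ := hA _ hσ
    have hmem : ∀ i ∈ σ, p i ∈ convexHull ℝ ((σ.map p : Finset E) : Set E) := fun i hi =>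
      subset_convexHull ℝ _ (by simpa using hi)
    rw [hg x, hx, g.map_sum_smul σ c hc1]
    · refine Finset.sum_congr rfl fun i hi => ?_
      rw [← hg (P i) (hmem i hi)]
      congr 1
      exact (ha i).symm
    · rw [hx]
      exact (convex_convexHull ℝ _).sum_mem (fun i _ => hc0 i) hc1 hmem

variable {ι : Type*} [Fintype ι] {p : ι ↪ E} {N : ℕ} {a : Equiv.Perm ι}

theorem permCoord_mem_space (ha : ∀ σ ∈ K.indexFaces p, σ.map a.toEmbedding ∈ K.indexFaces p)
    {y : EuclideanSpace ℝ ι} (hy : y ∈ (kuhnComplex (K.indexFaces p) N).space) :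
    permCoord a y ∈ (kuhnComplex (K.indexFaces p) N).space := by
  obtain ⟨hbd, ⟨i, hi⟩, σ, hσ, hs⟩ := mem_space_kuhnComplex.1 hy
  refine mem_space_kuhnComplex.2 ⟨fun j => ?_, ⟨a i, ?_⟩, _, ha σ hσ, fun j hj => ?_⟩
  · rw [permCoord_apply]; exact hbd _
  · rwa [permCoord_apply, Equiv.symm_apply_apply]
  · rw [permCoord_apply] at hj
    exact Finset.mem_map.2 ⟨_, hs _ hj, by simp⟩

/-- In the cube model `A` is a permutation of coordinates: it permutes vertices and keeps
barycentric weights. -/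
theorem coe_apply_kuhnHomeo (hp : K.vertices ⊆ Set.range p) (hN : 0 < N)
    (hA : ∀ σ ∈ K.indexFaces p, ∀ c : ι → ℝ, (∀ i, 0 ≤ c i) → ∑ i ∈ σ, c i = 1 →
        ∀ x : K.space, (x : E) = ∑ i ∈ σ, c i • p i → (A x : E) = ∑ i ∈ σ, c i • p (a i))
    (y : (kuhnComplex (K.indexFaces p) N).space) :
    (A (kuhnHomeo hp hN y) : E) = radialMap p (permCoord a y) := by
  obtain ⟨hbd, -, σ, hσ, hs⟩ := mem_space_kuhnComplex.1 y.2
  have hpos : 0 < ∑ i, (y : EuclideanSpace ℝ ι) i :=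
    lt_of_lt_of_le (by exact_mod_cast hN) (le_sum_of_mem_space y.2)
  have hzero : ∀ i ∉ σ, (∑ j, (y : EuclideanSpace ℝ ι) j)⁻¹ * (y : EuclideanSpace ℝ ι) i = 0 :=
    fun i hi => by
      rw [not_imp_comm.1 (hs i) hi, mul_zero]
  have hsub : ∀ q : ι → E, ∑ i ∈ σ, ((∑ j, (y : EuclideanSpace ℝ ι) j)⁻¹ *
      (y : EuclideanSpace ℝ ι) i) • q i = ∑ i, ((∑ j, (y : EuclideanSpace ℝ ι) j)⁻¹ *
      (y : EuclideanSpace ℝ ι) i) • q i := fun q =>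
    Finset.sum_subset (Finset.subset_univ _) fun i _ hi => by rw [hzero i hi, zero_smul]
  rw [radialMap_permCoord, ← hsub fun i => p (a i)]
  refine hA σ hσ (fun i => (∑ j, (y : EuclideanSpace ℝ ι) j)⁻¹ * (y : EuclideanSpace ℝ ι) i)
    (fun i => mul_nonneg (inv_nonneg.2 hpos.le) (hbd i).1) ?_ _ ?_
  · rw [← sum_normalized hpos]
    exact Finset.sum_subset (Finset.subset_univ _) fun i _ hi => hzero i hi
  · rw [coe_kuhnHomeo_apply, hsub fun i => p i, radialMap]

theorem exists_fin_embedding_range_eq_vertices (hK : K.faces.Finite) :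
    ∃ (d : ℕ) (p : Fin d ↪ E), Set.range p = K.vertices := by
  have hV : K.vertices.Finite := by
    rw [vertices_eq]
    exact hK.biUnion fun s _ => s.finite_toSet
  refine ⟨_, hV.toFinset.equivFin.symm.toEmbedding.trans (Function.Embedding.subtype _), ?_⟩
  ext v
  constructor
  · rintro ⟨i, rfl⟩
    exact hV.mem_toFinset.1 (hV.toFinset.equivFin.symm i).2
  · intro hv
    exact ⟨hV.toFinset.equivFin ⟨v, hV.mem_toFinset.2 hv⟩, by simp⟩

/-- Already for `N = 1` the cube model conjugates `A` to a linear isometry. -/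
theorem IsSimplicialSelfMap.continuous (hK : K.faces.Finite) (hA : IsSimplicialSelfMap K A)
    (hinv : Function.Involutive A) : Continuous A := by
  obtain ⟨d, p, hp⟩ := exists_fin_embedding_range_eq_vertices hK
  have hp' : K.vertices ⊆ Set.range p := hp.symm.subset
  obtain ⟨a, haface, haA⟩ := hA.exists_perm hinv p hp
  have h1 : (0 : ℕ) < 1 := one_pos
  have : A = fun x => kuhnHomeo (N := 1) hp' h1
      ⟨permCoord a ((kuhnHomeo hp' h1).symm x), permCoord_mem_space haface (Subtype.prop _)⟩ := by
    funext x
    apply Subtype.ext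
    conv_lhs => rw [← (kuhnHomeo hp' h1).apply_symm_apply x]
    rw [coe_apply_kuhnHomeo hp' h1 haA, coe_kuhnHomeo_apply]
  rw [this]
  fun_prop

theorem image_simplexCarrier_kuhnHomeo (hp : K.vertices ⊆ Set.range p) (hN : 0 < N)
    (haface : ∀ σ ∈ K.indexFaces p, σ.map a.toEmbedding ∈ K.indexFaces p)
    (haA : ∀ σ ∈ K.indexFaces p, ∀ c : ι → ℝ, (∀ i, 0 ≤ c i) → ∑ i ∈ σ, c i = 1 →
        ∀ x : K.space, (x : E) = ∑ i ∈ σ, c i • p i → (A x : E) = ∑ i ∈ σ, c i • p (a i))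
    {s : Finset (EuclideanSpace ℝ ι)} (hs : s ∈ (kuhnComplex (K.indexFaces p) N).faces) :
    A '' simplexCarrier (T := kuhnComplex (K.indexFaces p) N) (kuhnHomeo hp hN) s =
      simplexCarrier (T := kuhnComplex (K.indexFaces p) N) (kuhnHomeo hp hN) (s.map (permCoordEmbedding a)) := by
  have himage : convexHull ℝ ((s.map (permCoordEmbedding a) :
      Finset (EuclideanSpace ℝ ι)) : Set (EuclideanSpace ℝ ι)) =
      permCoord a '' convexHull ℝ (s : Set (EuclideanSpace ℝ ι)) := by
    rw [Finset.coe_map]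
    exact ((permCoord a).toLinearEquiv.toLinearMap.image_convexHull _).symm
  ext z
  constructor
  · rintro ⟨_, ⟨x, hx, rfl⟩, rfl⟩
    refine ⟨⟨permCoord a x, permCoord_mem_space haface x.2⟩, ?_, ?_⟩
    · show permCoord a x ∈ convexHull ℝ _
      rw [himage]
      exact Set.mem_image_of_mem _ hx
    · apply Subtype.ext
      rw [coe_apply_kuhnHomeo hp hN haA, coe_kuhnHomeo_apply]
  · rintro ⟨y, hy, rfl⟩
    have hy' : (y : EuclideanSpace ℝ ι) ∈ convexHull ℝ _ := hy
    rw [himage] at hy'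
    obtain ⟨x, hx, hxy⟩ := hy'
    have hxs : x ∈ (kuhnComplex (K.indexFaces p) N).space := convexHull_subset_space hs hx
    refine ⟨_, ⟨⟨x, hxs⟩, hx, rfl⟩, ?_⟩
    apply Subtype.ext
    rw [coe_apply_kuhnHomeo hp hN haA, coe_kuhnHomeo_apply, hxy]

/-- The polyhedron of a finite complex with a free simplicial involution has arbitrarily fine
antipodal triangulations. -/
theorem IsSimplicialSelfMap.exists_fine_antipodalTriangulation (hK : K.faces.Finite)
    (hA : IsSimplicialSelfMap K A) (hinv : Function.Involutive A) (hfree : ∀ x, A x ≠ x)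
    {ε : ℝ} (hε : 0 < ε) :
    ∃ T : AntipodalTriangulation K.space A, ∀ s ∈ T.complex.faces,
      ∀ x ∈ simplexCarrier T.homeo s, ∀ y ∈ simplexCarrier T.homeo s, dist x y < ε := by
  have hcpt : CompactSpace K.space := isCompact_iff_compactSpace.1 (isCompact_space K hK)
  obtain ⟨d, p, hp⟩ := exists_fin_embedding_range_eq_vertices hK
  have hp' : K.vertices ⊆ Set.range p := hp.symm.subset
  obtain ⟨a, haface, haA⟩ := hA.exists_perm hinv p hp
  -- By compactness a free map moves every point by a definite amount; simplices of smaller diameter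
  -- cannot meet their images.
  obtain ⟨δ, hδ, hAδ⟩ : ∃ δ > 0, ∀ x, δ ≤ dist x (A x) := by
    rcases isEmpty_or_nonempty K.space with h | h
    · exact ⟨1, one_pos, fun x => h.elim x⟩
    · obtain ⟨x, -, hx⟩ := isCompact_univ.exists_isMinOn Set.univ_nonempty
        (continuous_id.dist (hA.continuous hK hinv)).continuousOn
      exact ⟨_, dist_pos.2 (hfree x).symm, fun y => hx (Set.mem_univ y)⟩
  obtain ⟨C, hC⟩ : ∃ C, ∀ i, ‖p i‖ ≤ C := by
    obtain ⟨C, hC⟩ := (Set.finite_range fun i => ‖p i‖).bddAbove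
    exact ⟨C, fun i => hC ⟨i, rfl⟩⟩
  obtain ⟨N, hN, hNε⟩ : ∃ N : ℕ, 0 < N ∧ 2 * (Fintype.card (Fin d) * C) / N < min ε δ := by
    have := tendsto_const_div_atTop_nhds_zero_nat (2 * (Fintype.card (Fin d) * C))
    obtain ⟨N, h1, h2⟩ := ((this.eventually_lt_const (lt_min hε hδ)).and
      (Filter.eventually_gt_atTop 0)).exists
    exact ⟨N, h2, h1⟩
  have hmesh : ∀ s ∈ (kuhnComplex (K.indexFaces p) N).faces,
      ∀ x ∈ simplexCarrier (T := kuhnComplex (K.indexFaces p) N) (kuhnHomeo hp' hN) s, ∀ y ∈ simplexCarrier (T := kuhnComplex (K.indexFaces p) N) (kuhnHomeo hp' hN) s,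
      dist x y < min ε δ := by
    rintro s hs _ ⟨x, hx, rfl⟩ _ ⟨y, hy, rfl⟩
    refine lt_of_le_of_lt ?_ hNε
    exact dist_radialMap_le hN hC x.2 y.2 (abs_sub_le_one_of_mem_face hs hx hy)
  refine ⟨⟨d, kuhnComplex (K.indexFaces p) N, finite_faces_kuhnComplex, kuhnHomeo hp' hN,
    fun s hs => ⟨_, map_permCoord_mem_faces haface hs,
      image_simplexCarrier_kuhnHomeo hp' hN haface haA hs⟩, fun s hs => ?_⟩,
    fun s hs x hx y hy => (hmesh s hs x hx y hy).trans_le (min_le_left _ _)⟩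
  rw [Set.disjoint_left]
  rintro _ hx ⟨y, hy, rfl⟩
  exact absurd (hmesh s hs _ hy _ hx) (not_lt.2 ((min_le_right _ _).trans (hAδ y)))

end SimplicialInvolution

/-! ### Continuous extension of vertex maps. -/

section SimplicialMap

open Geometry.SimplicialComplex

variable {F W : Type*} [NormedAddCommGroup F] [NormedSpace ℝ F] [NormedAddCommGroup W]
  [NormedSpace ℝ W] {K : Geometry.SimplicialComplex ℝ F}

/-- A map of the vertices of a finite complex extends to a continuous map which sends every simplex
into the convex hull of the images of its vertices. -/
theorem Geometry.SimplicialComplex.exists_continuous_extension (hK : K.faces.Finite) (p : F → W) :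
    ∃ f : K.space → W, Continuous f ∧ ∀ s ∈ K.faces, ∀ x : K.space,
      (x : F) ∈ convexHull ℝ (s : Set F) → f x ∈ convexHull ℝ (p '' (s : Set F)) := by
  classical
  -- `C v` is the complement of the open star of `v`
  set C : F → Set F := fun v => ⋃ s ∈ {s ∈ K.faces | v ∉ s}, convexHull ℝ (s : Set F) with hC
  have hCclosed : ∀ v, IsClosed (C v) := fun v =>
    (hK.subset (Set.sep_subset _ _)).isClosed_biUnion fun s _ =>
      (s.finite_toSet.isCompact_convexHull ℝ).isClosed
  -- The empty case is separate because `Metric.infDist` to the empty set is `0`, whereas a positive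
  -- weight is needed.
  set φ : F → F → ℝ := fun v x => if C v = ∅ then 1 else Metric.infDist x (C v) with hφ
  have hφcont : ∀ v, Continuous (φ v) := fun v => by
    simp only [hφ]
    split_ifs
    · exact continuous_const
    · exact Metric.continuous_infDist_pt _
  have hφ0 : ∀ v x, 0 ≤ φ v x := fun v x => by
    simp only [hφ]
    split_ifs
    · exact zero_le_one
    · exact Metric.infDist_nonneg
  have hφmem : ∀ v x, x ∈ C v → φ v x = 0 := fun v x hx => by
    simp only [hφ]
    rw [if_neg (Set.nonempty_iff_ne_empty.1 ⟨x, hx⟩), Metric.infDist_zero_of_mem hx]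
  have hφpos : ∀ v x, x ∉ C v → 0 < φ v x := fun v x hx => by
    simp only [hφ]
    split_ifs with h
    · exact one_pos
    · exact ((hCclosed v).notMem_iff_infDist_pos (Set.nonempty_iff_ne_empty.2 h)).1 hx
  set V : Finset F := hK.toFinset.biUnion id with hV
  have hsum : ∀ x ∈ K.space, 0 < ∑ v ∈ V, φ v x := by
    intro x hx
    -- A minimal face containing `x` lies in every face containing `x`, so `x` is in the open star
    -- of each of its vertices.
    obtain ⟨s, ⟨hs, hxs⟩, hmin⟩ := exists_minimal_of_wellFoundedLT
      (fun s : Finset F => s ∈ K.faces ∧ x ∈ convexHull ℝ (s : Set F)) (mem_space_iff.1 hx)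
    obtain ⟨v, hv⟩ := K.nonempty_of_mem_faces hs
    refine Finset.sum_pos' (fun v _ => hφ0 v x) ⟨v, Finset.mem_biUnion.2
      ⟨s, hK.mem_toFinset.2 hs, hv⟩, hφpos v x fun h => ?_⟩
    obtain ⟨t, ⟨ht, hvt⟩, hxt⟩ := Set.mem_iUnion₂.1 h
    have hst := K.inter_subset_convexHull hs ht ⟨hxs, hxt⟩
    rw [← Finset.coe_inter] at hst
    have hne : (s ∩ t).Nonempty := Finset.coe_nonempty.1 (convexHull_nonempty_iff.1 ⟨x, hst⟩)
    have := hmin ⟨K.down_closed hs Finset.inter_subset_left hne, hst⟩ Finset.inter_subset_left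
    exact hvt (Finset.mem_inter.1 (this hv)).2
  refine ⟨fun x => V.centerMass (fun v => φ v x) p, ?_, fun s hs x hx => ?_⟩
  · unfold Finset.centerMass
    refine Continuous.smul (Continuous.inv₀ ?_ fun x => (hsum x x.2).ne') ?_
    · exact continuous_finsetSum _ fun v _ => (hφcont v).comp continuous_subtype_val
    · exact continuous_finsetSum _ fun v _ =>
        ((hφcont v).comp continuous_subtype_val).smul continuous_const
  · dsimp only
    rw [← Finset.centerMass_filter_ne_zero]
    refine Finset.centerMass_mem_convexHull _ (fun v _ => hφ0 v x) ?_ fun v hv => ?_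
    · rw [Finset.sum_filter_ne_zero]
      exact hsum x x.2
    · refine Set.mem_image_of_mem p ?_
      by_contra hvs
      exact (Finset.mem_filter.1 hv).2 (hφmem v x (Set.mem_biUnion (x := s) ⟨hs, hvs⟩ hx))

end SimplicialMap

/-! ### Combinatorics of antipodal labelings. -/

theorem SignedLabel.val_neg {m : ℕ} (k : SignedLabel m) : (-k).1 = -k.1 := rfl

theorem SignedLabel.neg_neg {m : ℕ} (k : SignedLabel m) : -(-k) = k :=
  Subtype.ext (_root_.neg_neg k.1)

namespace AntipodalTriangulation

open Geometry.SimplicialComplex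

variable {X : Type*} [TopologicalSpace X] {A : X → X} (T : AntipodalTriangulation X A) {m n : ℕ}

theorem point_injective : Function.Injective T.point := fun _ _ h =>
  Subtype.ext (Subtype.ext_iff (p := (· ∈ T.complex.space)).1 (T.homeo.injective h))

theorem point_mem_simplexCarrier {s : Finset (EuclideanSpace ℝ (Fin T.dim))} {v : T.Vertex}
    (hv : v.1 ∈ s) : T.point v ∈ simplexCarrier T.homeo s :=
  ⟨_, subset_convexHull ℝ _ (Finset.mem_coe.2 hv), rfl⟩

theorem point_mem_simplexCarrier_iff {s : Finset (EuclideanSpace ℝ (Fin T.dim))}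
    (hs : s ∈ T.complex.faces) {v : T.Vertex} :
    T.point v ∈ simplexCarrier T.homeo s ↔ v.1 ∈ s := by
  refine ⟨?_, T.point_mem_simplexCarrier⟩
  rintro ⟨x, hx, hxv⟩
  have : x = ⟨v.1, vertices_subset_space v.2⟩ := T.homeo.injective hxv
  rw [this] at hx
  exact (vertex_mem_convexHull_iff v.2 hs).1 hx

variable {T}

theorem exists_antipodal_face (hinv : Function.Involutive A)
    {s : Finset (EuclideanSpace ℝ (Fin T.dim))} (hs : s ∈ T.complex.faces) :
    ∃ t ∈ T.complex.faces, A '' simplexCarrier T.homeo s = simplexCarrier T.homeo t ∧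
      ∀ v : T.Vertex, v.1 ∈ t ↔ (T.antipode v).1 ∈ s := by
  obtain ⟨t, ht, h⟩ := T.exists_image_eq s hs
  refine ⟨t, ht, h, fun v => ?_⟩
  rw [← T.point_mem_simplexCarrier_iff ht, ← T.point_mem_simplexCarrier_iff hs, T.point_antipode,
    ← h]
  constructor
  · rintro ⟨x, hx, hxv⟩
    rwa [← hxv, hinv]
  · exact fun hv => ⟨_, hv, hinv _⟩

theorem antipode_antipode (hinv : Function.Involutive A) (v : T.Vertex) :
    T.antipode (T.antipode v) = v :=
  T.point_injective (by rw [T.point_antipode, T.point_antipode, hinv])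

theorem mem_labelSet_antipodal {L : T.Vertex → SignedLabel m} (hL : T.IsAntipodalLabeling L)
    (hinv : Function.Involutive A) {s t : Finset (EuclideanSpace ℝ (Fin T.dim))}
    (h : ∀ v : T.Vertex, v.1 ∈ t ↔ (T.antipode v).1 ∈ s) (k : SignedLabel m) :
    k ∈ T.labelSet L t ↔ -k ∈ T.labelSet L s := by
  constructor
  · rintro ⟨v, hv, rfl⟩
    exact ⟨T.antipode v, (h v).1 hv, hL v⟩
  · rintro ⟨v, hv, hvk⟩
    refine ⟨T.antipode v, (h _).2 ?_, ?_⟩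
    · rwa [antipode_antipode hinv]
    · rw [hL, hvk, SignedLabel.neg_neg]

theorem hasComplementaryEdge_of_mem_labelSet {L : T.Vertex → SignedLabel m}
    {s : Finset (EuclideanSpace ℝ (Fin T.dim))} (hs : s ∈ T.complex.faces) {k : SignedLabel m}
    (hk : k ∈ T.labelSet L s) (hk' : -k ∈ T.labelSet L s) : T.HasComplementaryEdge L := by
  classical
  obtain ⟨u, hu, rfl⟩ := hk
  obtain ⟨v, hv, hvu⟩ := hk'
  refine ⟨u, v, ?_, ⟨{u.1, v.1}, T.complex.down_closed hs ?_ (Finset.insert_nonempty _ _), by simp⟩,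
    by rw [hvu, SignedLabel.neg_neg]⟩
  · rintro rfl
    have := congrArg Subtype.val hvu
    rw [SignedLabel.val_neg] at this
    have h0 := (L u).2.1
    omega
  · intro x hx
    rcases Finset.mem_insert.1 hx with rfl | hx
    · exact hu
    · rw [Finset.mem_singleton.1 hx]
      exact hv

/-- The face may carry further labels: vertices with the required labels are distinct, since their
moduli are, and span an `n`-face of it. -/
theorem hasAlternatingSimplex_of_mem_labelSet {L : T.Vertex → SignedLabel m}
    {s : Finset (EuclideanSpace ℝ (Fin T.dim))} (hs : s ∈ T.complex.faces) {k : Fin (n + 1) → ℕ}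
    (hk : StrictMono k)
    (h : ∀ i : Fin (n + 1), ∃ l ∈ T.labelSet L s, l.1 = (-1 : ℤ) ^ (i : ℕ) * (k i : ℤ)) :
    T.HasAlternatingSimplex L n := by
  classical
  have h' : ∀ i : Fin (n + 1), ∃ v : T.Vertex, v.1 ∈ s ∧
      (L v).1 = (-1 : ℤ) ^ (i : ℕ) * (k i : ℤ) := fun i => by
    obtain ⟨-, ⟨v, hv, rfl⟩, hl⟩ := h i
    exact ⟨v, hv, hl⟩
  choose v hvs hv using h'
  have habs : ∀ i, |(L (v i)).1| = k i := fun i => by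
    rw [hv, abs_mul, abs_pow, abs_neg, abs_one, one_pow, one_mul, Nat.abs_cast]
  have hinj : Function.Injective fun i => (v i).1 := fun i j hij => by
    have : v i = v j := Subtype.ext hij
    apply hk.injective
    have h1 := habs i
    rw [this, habs j] at h1
    exact_mod_cast h1.symm
  refine ⟨Finset.univ.image fun i => (v i).1, T.complex.down_closed hs ?_ ?_, ?_, k, hk,
    fun i => ⟨?_, ?_⟩, ?_⟩
  · intro x hx
    obtain ⟨i, -, rfl⟩ := Finset.mem_image.1 hx
    exact hvs i
  · exact Finset.univ_nonempty.image _
  · rw [Finset.card_image_of_injective _ hinj, Finset.card_univ, Fintype.card_fin]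
  · have := abs_pos.2 (L (v i)).2.1
    rw [habs] at this
    exact_mod_cast this
  · have := (L (v i)).2.2
    rw [habs] at this
    exact_mod_cast this
  · ext z
    constructor
    · rintro ⟨-, ⟨u, hu, rfl⟩, rfl⟩
      obtain ⟨i, -, hi⟩ := Finset.mem_image.1 (Set.mem_ofPred_eq ▸ hu)
      exact ⟨i, by rw [← Subtype.ext hi]; exact (hv i).symm⟩
    · rintro ⟨i, rfl⟩
      exact ⟨L (v i), ⟨v i, Set.mem_ofPred_eq ▸ Finset.mem_image_of_mem (fun i => (v i).1) (Finset.mem_univ i), rfl⟩, hv i⟩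

end AntipodalTriangulation

/-! ### Coincidences give `P_n`; `P_n` and Ky Fan each give Tucker. -/

section Implications

open AntipodalTriangulation

variable {X : Type*} [TopologicalSpace X] {A : X → X} {n : ℕ}

/-- The continuous extension need not be odd; it is enough that it respects simplices. Injectivity
of `p` is left out so that `momentPoint` can be used, which is not injective for `n ≤ 1` and `m ≥
2`. -/
theorem IsBUTSpace.exists_zero_mem_convexHull (h : IsBUTSpace X A n)
    (hinv : Function.Involutive A) {m : ℕ} {p : SignedLabel m → EuclideanSpace ℝ (Fin n)}
    (hp : ∀ k, p (-k) = -p k) (T : AntipodalTriangulation X A) {L : T.Vertex → SignedLabel m}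
    (hL : T.IsAntipodalLabeling L) :
    ∃ s ∈ T.complex.faces,
      (0 : EuclideanSpace ℝ (Fin n)) ∈ convexHull ℝ (p '' T.labelSet L s) := by
  classical
  set q : EuclideanSpace ℝ (Fin T.dim) → EuclideanSpace ℝ (Fin n) := fun x =>
    if hx : x ∈ T.complex.vertices then p (L ⟨x, hx⟩) else 0 with hq
  obtain ⟨f, hf, hfs⟩ := T.complex.exists_continuous_extension T.finite_faces q
  have himage : ∀ s ∈ T.complex.faces, q '' (s : Set _) ⊆ p '' T.labelSet L s := by
    rintro s hs _ ⟨x, hx, rfl⟩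
    have hxv : x ∈ T.complex.vertices :=
      T.complex.down_closed hs (Finset.singleton_subset_iff.2 hx) (Finset.singleton_nonempty x)
    exact ⟨L ⟨x, hxv⟩, ⟨⟨x, hxv⟩, hx, rfl⟩, by rw [hq]; simp [hxv]⟩
  have hmem : ∀ s ∈ T.complex.faces, ∀ x ∈ simplexCarrier T.homeo s,
      f (T.homeo.symm x) ∈ convexHull ℝ (p '' T.labelSet L s) := by
    rintro s hs _ ⟨x, hx, rfl⟩
    rw [T.homeo.symm_apply_apply]
    exact convexHull_mono (himage s hs) (hfs s hs x hx)
  obtain ⟨x, hx⟩ := h (fun x => f (T.homeo.symm x)) (hf.comp T.homeo.symm.continuous)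
  obtain ⟨s, hs, hxs⟩ := Geometry.SimplicialComplex.mem_space_iff.1 (T.homeo.symm x).2
  have hxs' : x ∈ simplexCarrier T.homeo s := ⟨_, hxs, T.homeo.apply_symm_apply x⟩
  obtain ⟨t, ht, hst, htv⟩ := exists_antipodal_face hinv hs
  refine ⟨s, hs, ?_⟩
  have h1 := hmem s hs x hxs'
  have h2 := hmem t ht (A x) (hst ▸ Set.mem_image_of_mem A hxs')
  have hneg : p '' T.labelSet L t ⊆ -(p '' T.labelSet L s) := by
    rintro _ ⟨k, hk, rfl⟩
    exact ⟨-k, (mem_labelSet_antipodal hL hinv htv k).1 hk, hp k⟩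
  have h3 := convexHull_mono hneg h2
  rw [convexHull_neg] at h3
  rw [hx] at h3
  have := (convex_convexHull ℝ _).midpoint_mem h1 (Set.mem_neg.1 h3)
  rwa [midpoint_self_neg] at this

theorem IsBUTSpace.isPSpace (h : IsBUTSpace X A n) (hinv : Function.Involutive A) :
    IsPSpace X A n :=
  fun _ _ _ hp T _ hL => h.exists_zero_mem_convexHull hinv hp T hL

/-- A set of real points on which a linear form is positive does not have the origin in its convex
hull. -/
theorem zero_notMem_convexHull_of_pos {V : Type*} [AddCommGroup V] [Module ℝ V] {s : Set V}
    (φ : V →ₗ[ℝ] ℝ) (h : ∀ x ∈ s, 0 < φ x) : (0 : V) ∉ convexHull ℝ s := fun h0 => by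
  have := convexHull_min (t := φ ⁻¹' Set.Ioi 0) h ((convex_Ioi 0).linear_preimage φ) h0
  simp at this

/-- The linear form on `ℝⁿ` with given coefficients. -/
def coordForm (c : Fin n → ℝ) : EuclideanSpace ℝ (Fin n) →ₗ[ℝ] ℝ where
  toFun y := ∑ j, c j * y j
  map_add' x y := by simp [mul_add, Finset.sum_add_distrib]
  map_smul' r x := by simp [Finset.mul_sum, mul_left_comm]

theorem coordForm_apply (c : Fin n → ℝ) (y : EuclideanSpace ℝ (Fin n)) :
    coordForm c y = ∑ j, c j * y j := rfl

theorem IsPSpace.isDiscreteTuckerSpace (h : IsPSpace X A n) : IsDiscreteTuckerSpace X A n := by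
  classical
  intro T L hL
  have hidx : ∀ k : SignedLabel n, k.1.natAbs - 1 < n := fun k => by
    have h0 := Int.natAbs_pos.2 k.2.1
    have h1 : (k.1.natAbs : ℤ) ≤ n := Int.natCast_natAbs k.1 ▸ k.2.2
    omega
  set idx : SignedLabel n → Fin n := fun k => ⟨k.1.natAbs - 1, hidx k⟩ with hidx'
  set p : SignedLabel n → EuclideanSpace ℝ (Fin n) := fun k =>
    EuclideanSpace.single (idx k) (k.1.sign : ℝ) with hp
  have hidx_eq : ∀ k l : SignedLabel n, idx k = idx l → k.1.natAbs = l.1.natAbs := fun k l hkl => by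
    have h1 : k.1.natAbs - 1 = l.1.natAbs - 1 := Fin.ext_iff.1 hkl
    have h2 := k.2.1
    have h3 := l.2.1
    omega
  have hp_inj : Function.Injective p := fun k l hkl => by
    have hsign : (k.1.sign : ℝ) ≠ 0 := by
      exact_mod_cast mt Int.sign_eq_zero_iff_zero.1 k.2.1
    have h1 := congrArg (fun y : EuclideanSpace ℝ (Fin n) => y (idx k)) hkl
    simp only [hp, PiLp.single_apply, if_true] at h1
    split_ifs at h1 with h2
    · have h3 := hidx_eq k l h2
      have h4 : k.1.sign = l.1.sign := by exact_mod_cast h1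
      apply Subtype.ext
      rw [← Int.sign_mul_natAbs k.1, h3, h4, Int.sign_mul_natAbs]
    · exact absurd h1 hsign
  have hp_neg : ∀ k, p (-k) = -p k := fun k => by
    have h1 : idx (-k) = idx k := by
      apply Fin.ext
      simp only [hidx', SignedLabel.val_neg, Int.natAbs_neg]
    ext j
    simp only [hp, h1, SignedLabel.val_neg, Int.sign_neg]
    rw [PiLp.neg_apply, PiLp.single_apply, PiLp.single_apply]
    split_ifs <;> simp
  obtain ⟨s, hs, h0⟩ := h n p hp_inj hp_neg T L hL
  by_contra hcon
  -- Without complementary edges each coordinate occurs with one sign only, and the form takes that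
  -- sign as coefficient; `-1` is harmless where no label occurs.
  refine zero_notMem_convexHull_of_pos (coordForm fun j : Fin n =>
    if ∃ l ∈ T.labelSet L s, idx l = j ∧ 0 < l.1 then (1 : ℝ) else -1) ?_ h0
  rintro _ ⟨k, hk, rfl⟩
  have hval : coordForm (fun j : Fin n =>
      if ∃ l ∈ T.labelSet L s, idx l = j ∧ 0 < l.1 then (1 : ℝ) else -1) (p k) =
      (if ∃ l ∈ T.labelSet L s, idx l = idx k ∧ 0 < l.1 then (1 : ℝ) else -1) * k.1.sign := by
    simp only [coordForm_apply, hp, PiLp.single_apply, mul_ite, mul_zero,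
      Finset.sum_ite_eq', Finset.mem_univ, if_true]
  rw [hval]
  rcases lt_or_gt_of_ne k.2.1 with hk0 | hk0
  · rw [if_neg, Int.sign_eq_neg_one_of_neg hk0]
    · norm_num
    · rintro ⟨l, hl, hlk, hl0⟩
      refine hcon (hasComplementaryEdge_of_mem_labelSet hs hl (k := l) ?_)
      convert hk
      apply Subtype.ext
      have := hidx_eq l k hlk
      rw [SignedLabel.val_neg]
      omega
  · rw [if_pos ⟨k, hk, rfl, hk0⟩, Int.sign_eq_one_of_pos hk0]
    norm_num

theorem IsKyFanSpace.isDiscreteTuckerSpace (h : IsKyFanSpace X A n) :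
    IsDiscreteTuckerSpace X A n := by
  intro T L hL
  by_contra hcon
  obtain ⟨-, -, -, k, hk, hbd, -⟩ := h n T L hL hcon
  -- Strict growth from `1` forces `k n ≥ n + 1`, beyond the largest label `n`.
  have hle : ∀ i : Fin (n + 1), (i : ℕ) + 1 ≤ k i := fun i => by
    induction i using Fin.induction with
    | zero => simpa using (hbd 0).1
    | succ i ih =>
      have := hk i.castSucc_lt_succ
      simp only [Fin.val_castSucc, Fin.val_succ] at ih ⊢
      omega
  have h1 := hle (Fin.last n)
  have h2 := (hbd (Fin.last n)).2
  simp only [Fin.val_last] at h1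
  omega

end Implications

/-! ### Sign changes and interpolating polynomials. -/

section Alternating

open Polynomial

/-- A finite set of naturals with signs contains an alternating sequence of length `r + 1` and
there is a polynomial of degree at most `r` which has the given signs on the set. -/
theorem exists_alternating_sequence (σ : ℕ → ℝ) (hσ : ∀ d, σ d = 1 ∨ σ d = -1) (D : Finset ℕ)
    (hD : D.Nonempty) :
    ∃ (r : ℕ) (k : ℕ → ℕ) (q : ℝ[X]), (∀ i < r, k i < k (i + 1)) ∧ (∀ i ≤ r, k i ∈ D) ∧
      (∀ i ≤ r, σ (k i) = (-1) ^ i * σ (k 0)) ∧ q.natDegree ≤ r ∧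
      (∀ d ∈ D, 0 < σ d * q.eval (d : ℝ)) ∧ ∀ x : ℕ, k r ≤ x → 0 < σ (k r) * q.eval (x : ℝ) := by
  have hsq : ∀ d, 0 < σ d * σ d := fun d => by
    rcases hσ d with h | h <;> rw [h] <;> norm_num
  induction D using Finset.induction_on_max with
  | empty => exact absurd hD (by simp)
  | insert a D ha ih =>
    rcases D.eq_empty_or_nonempty with rfl | hne
    · exact ⟨0, fun _ => a, C (σ a), by simp, by simp, by simp, by simp, by simpa using hsq a,
        fun x _ => by simpa using hsq a⟩
    · obtain ⟨r, k, q, hk, hkD, hkσ, hq, hqD, hqt⟩ := ih hne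
      have hka : k r < a := ha _ (hkD r le_rfl)
      -- If the new largest element repeats the last sign, `q` still works by the clause about all
      -- `x ≥ k r`, which is carried along for this purpose.
      by_cases hs : σ a = σ (k r)
      · refine ⟨r, k, q, hk, fun i hi => Finset.mem_insert_of_mem (hkD i hi), hkσ, hq, ?_, hqt⟩
        intro d hd
        rcases Finset.mem_insert.1 hd with rfl | hd
        · rw [hs]
          exact hqt d hka.le
        · exact hqD d hd
      · have hs' : σ a = -σ (k r) := by
          rcases hσ a with h1 | h1 <;> rcases hσ (k r) with h2 | h2 <;>
            first | exact absurd (h1.trans h2.symm) hs | simp [h1, h2]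
        -- The extra root `a - 1/2` separates `a` from all smaller naturals: the new factor is
        -- positive on `D` and negative from `a` on.
        have htail : ∀ x : ℕ, a ≤ x → 0 < σ a * (q * (C ((a : ℝ) - 1 / 2) - X)).eval (x : ℝ) := by
          intro x hx
          have h1 := hqt x (hka.le.trans hx)
          have h2 : (a : ℝ) ≤ x := by exact_mod_cast hx
          rw [hs']
          simp only [eval_mul, eval_sub, eval_C, eval_X]
          have := mul_pos h1 (by linarith : (0 : ℝ) < x - (a - 1 / 2))
          linarith
        refine ⟨r + 1, fun i => if i ≤ r then k i else a, q * (C ((a : ℝ) - 1 / 2) - X),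
          fun i hi => ?_, fun i hi => ?_, fun i hi => ?_, ?_, fun d hd => ?_, fun x hx => ?_⟩
        · have hir : i ≤ r := Nat.lt_succ_iff.1 hi
          dsimp only
          rw [if_pos hir]
          split_ifs with h
          · exact hk i h
          · rwa [le_antisymm hir (by omega)]
        · dsimp only
          split_ifs with h
          · exact Finset.mem_insert_of_mem (hkD i h)
          · exact Finset.mem_insert_self _ _
        · simp only [Nat.zero_le, if_true]
          split_ifs with h
          · exact hkσ i h
          · have : i = r + 1 := by omega
            rw [this, hs', hkσ r le_rfl, pow_succ]
            ring
        · refine natDegree_mul_le.trans (add_le_add hq ?_)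
          refine (natDegree_sub_le _ _).trans ?_
          simp
        · rcases Finset.mem_insert.1 hd with rfl | hd
          · exact htail d le_rfl
          · have h1 := hqD d hd
            have h2 : (d : ℝ) + 1 ≤ a := by exact_mod_cast ha d hd
            simp only [eval_mul, eval_sub, eval_C, eval_X]
            rw [← mul_assoc]
            exact mul_pos h1 (by linarith)
        · simp only [show ¬ r + 1 ≤ r by omega, if_false] at hx ⊢
          exact htail x hx

end Alternating

/-! ### The moment curve and Ky Fan's property. -/

section Implications

open AntipodalTriangulation

variable {X : Type*} [TopologicalSpace X] {A : X → X} {n : ℕ}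

/-- The label `±k` placed at `±(1, k, …, kⁿ⁻¹)`. -/
noncomputable def momentPoint (n : ℕ) {m : ℕ} (l : SignedLabel m) : EuclideanSpace ℝ (Fin n) :=
  WithLp.toLp 2 fun j => (l.1.sign : ℝ) * (l.1.natAbs : ℝ) ^ (j : ℕ)

theorem momentPoint_neg {m : ℕ} (l : SignedLabel m) : momentPoint n (-l) = -momentPoint n l := by
  ext j
  simp [momentPoint, SignedLabel.val_neg]

theorem coordForm_momentPoint {m : ℕ} (q : Polynomial ℝ) (hq : q.natDegree < n)
    (l : SignedLabel m) :
    coordForm (fun j : Fin n => q.coeff j) (momentPoint n l) =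
      l.1.sign * q.eval (l.1.natAbs : ℝ) := by
  rw [coordForm_apply, Polynomial.eval_eq_sum_range' hq, Finset.mul_sum,
    ← Fin.sum_univ_eq_sum_range fun j => (l.1.sign : ℝ) * (q.coeff j * (l.1.natAbs : ℝ) ^ j)]
  exact Finset.sum_congr rfl fun j _ => mul_left_comm _ _ _

/-- Fewer than `n` sign changes would allow a polynomial of degree less than `n` with the prescribed
signs, that is, a linear form positive on all the points. The two alternatives are the two possible
signs of the first term. -/
theorem exists_alternating_of_zero_mem_convexHull {m : ℕ} {S : Set (SignedLabel m)}
    (hS : ∀ l ∈ S, -l ∉ S) (h0 : (0 : EuclideanSpace ℝ (Fin n)) ∈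
      convexHull ℝ (momentPoint n '' S)) :
    ∃ k : Fin (n + 1) → ℕ, StrictMono k ∧
      ((∀ i : Fin (n + 1), ∃ l ∈ S, l.1 = (-1 : ℤ) ^ (i : ℕ) * (k i : ℤ)) ∨
        ∀ i : Fin (n + 1), ∃ l ∈ S, l.1 = -((-1 : ℤ) ^ (i : ℕ) * (k i : ℤ))) := by
  classical
  set D : Finset ℕ := (Finset.range (m + 1)).filter fun d => ∃ l ∈ S, l.1.natAbs = d with hD
  set σ : ℕ → ℝ := fun d => if ∃ l ∈ S, l.1 = d then 1 else -1 with hσ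
  have hσS : ∀ l ∈ S, σ l.1.natAbs = l.1.sign := by
    intro l hl
    rcases lt_or_gt_of_ne l.2.1 with h | h
    · rw [Int.sign_eq_neg_one_of_neg h, hσ]
      simp only
      rw [if_neg]
      · norm_num
      · rintro ⟨l', hl', h'⟩
        refine hS l hl ?_
        convert hl'
        apply Subtype.ext
        rw [SignedLabel.val_neg, h']
        omega
    · rw [Int.sign_eq_one_of_pos h, hσ]
      simp only
      rw [if_pos ⟨l, hl, by omega⟩]
      norm_num
  have hDS : ∀ l ∈ S, l.1.natAbs ∈ D := fun l hl => by
    refine Finset.mem_filter.2 ⟨Finset.mem_range.2 ?_, l, hl, rfl⟩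
    have h1 : (l.1.natAbs : ℤ) ≤ m := Int.natCast_natAbs l.1 ▸ l.2.2
    omega
  have hDne : D.Nonempty := by
    have : (momentPoint n '' S).Nonempty := convexHull_nonempty_iff.1 ⟨0, h0⟩
    obtain ⟨-, l, hl, -⟩ := this
    exact ⟨_, hDS l hl⟩
  obtain ⟨r, k, q, hk, hkD, hkσ, hq, hqD, -⟩ := exists_alternating_sequence σ
    (fun d => by simp only [hσ]; split_ifs <;> simp) D hDne
  have hr : n ≤ r := by
    by_contra hr
    refine zero_notMem_convexHull_of_pos (coordForm fun j : Fin n => q.coeff j) ?_ h0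
    rintro _ ⟨l, hl, rfl⟩
    rw [coordForm_momentPoint q (by omega), ← hσS l hl]
    exact hqD _ (hDS l hl)
  have hkS : ∀ i ≤ r, ∃ l ∈ S, (l.1 : ℝ) = σ (k i) * k i := fun i hi => by
    obtain ⟨-, l, hl, hlk⟩ := Finset.mem_filter.1 (hkD i hi)
    refine ⟨l, hl, ?_⟩
    rw [← hlk, hσS l hl]
    have h1 := congrArg (Int.cast : ℤ → ℝ) (Int.sign_mul_natAbs l.1)
    rw [Int.cast_mul, Int.cast_natCast] at h1
    exact h1.symm
  refine ⟨fun i => k i, Fin.strictMono_iff_lt_succ.2 fun i => ?_, ?_⟩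
  · simpa using hk i (by omega)
  have h0σ : σ (k 0) = 1 ∨ σ (k 0) = -1 := by
    simp only [hσ]; split_ifs <;> simp
  refine h0σ.imp (fun h i => ?_) fun h i => ?_ <;>
  · have hi : (i : ℕ) ≤ r := by omega
    obtain ⟨l, hl, hlk⟩ := hkS i hi
    refine ⟨l, hl, ?_⟩
    rw [hkσ i hi, h] at hlk
    rw [← Int.cast_inj (α := ℝ), hlk]
    push_cast
    ring

theorem IsBUTSpace.isKyFanSpace (h : IsBUTSpace X A n) (hinv : Function.Involutive A) :
    IsKyFanSpace X A n := by
  intro m T L hL hcon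
  obtain ⟨s, hs, h0⟩ := h.exists_zero_mem_convexHull hinv (momentPoint_neg (n := n)) T hL
  obtain ⟨k, hk, hk'⟩ := exists_alternating_of_zero_mem_convexHull
    (fun l hl hl' => hcon (hasComplementaryEdge_of_mem_labelSet hs hl hl')) h0
  rcases hk' with h1 | h1
  · exact hasAlternatingSimplex_of_mem_labelSet hs hk h1
  -- A sequence that starts with a negative label becomes one of the required kind on the antipodal
  -- face.
  · obtain ⟨t, ht, -, htv⟩ := exists_antipodal_face hinv hs
    refine hasAlternatingSimplex_of_mem_labelSet ht hk fun i => ?_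
    obtain ⟨l, hl, hlk⟩ := h1 i
    refine ⟨-l, (mem_labelSet_antipodal hL hinv htv _).2 ?_, ?_⟩
    · rwa [SignedLabel.neg_neg]
    · rw [SignedLabel.val_neg, hlk, _root_.neg_neg]

end Implications

/-! ### From Tucker's property to coincidences. -/

section TuckerToBorsukUlam

/-- The label `±(i + 1)`, with the sign of the nonzero number `r`. -/
noncomputable def signLabel {n : ℕ} (i : Fin n) (r : ℝ) : SignedLabel n :=
  ⟨if 0 < r then (i : ℤ) + 1 else -((i : ℤ) + 1), by split_ifs <;> omega, by
    have := i.2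
    split_ifs
    · rw [abs_of_nonneg] <;> omega
    · rw [abs_neg, abs_of_nonneg] <;> omega⟩

theorem signLabel_neg {n : ℕ} (i : Fin n) {r : ℝ} (hr : r ≠ 0) :
    signLabel i (-r) = -signLabel i r := by
  apply Subtype.ext
  rw [SignedLabel.val_neg]
  rcases lt_or_gt_of_ne hr with h | h <;> simp [signLabel, h, not_lt.2 h.le]

theorem eq_of_signLabel_eq_neg {n : ℕ} {i j : Fin n} {r t : ℝ}
    (h : signLabel i r = -signLabel j t) : i = j ∧ (0 < r ↔ ¬ 0 < t) := by
  have h' := congrArg Subtype.val h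
  rw [SignedLabel.val_neg] at h'
  simp only [signLabel] at h'
  split_ifs at h' with h1 h2 h2
  · omega
  · exact ⟨Fin.ext (by omega), by tauto⟩
  · exact ⟨Fin.ext (by omega), by tauto⟩
  · omega

variable {E : Type*} [NormedAddCommGroup E] [NormedSpace ℝ E]
  {K : Geometry.SimplicialComplex ℝ E} {A : K.space → K.space} {n : ℕ}

theorem IsDiscreteTuckerSpace.isBUTSpace (hK : K.faces.Finite) (hA : IsSimplicialSelfMap K A)
    (hinv : Function.Involutive A) (hfree : ∀ x, A x ≠ x)
    (h : IsDiscreteTuckerSpace K.space A n) : IsBUTSpace K.space A n := by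
  intro f hf
  by_contra! hne
  have hcpt : CompactSpace K.space :=
    isCompact_iff_compactSpace.1 (Geometry.SimplicialComplex.isCompact_space K hK)
  set g : K.space → Fin n → ℝ := fun x i => f x i - f (A x) i with hg
  have hAc := hA.continuous hK hinv
  have hgcont : Continuous g := by fun_prop
  have hgA : ∀ x, g (A x) = -g x := fun x => by
    funext i
    simp only [hg, hinv x, Pi.neg_apply]
    ring
  have hg0 : ∀ x, g x ≠ 0 := fun x hx => hne x (by
    ext i
    have := congrFun hx i
    simp only [hg, Pi.zero_apply] at this
    linarith)
  obtain ⟨c, hc, hcg⟩ : ∃ c > 0, ∀ x, c ≤ ‖g x‖ := by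
    rcases isEmpty_or_nonempty K.space with h | h
    · exact ⟨1, one_pos, fun x => h.elim x⟩
    · obtain ⟨x, -, hx⟩ := isCompact_univ.exists_isMinOn Set.univ_nonempty hgcont.norm.continuousOn
      exact ⟨_, norm_pos_iff.2 (hg0 x), fun y => hx (Set.mem_univ y)⟩
  -- a coordinate of maximal modulus, the same one at `x` and at `A x`
  obtain ⟨idx, hidxA, hidx⟩ : ∃ idx : K.space → Fin n, (∀ x, idx (A x) = idx x) ∧
      ∀ x, c ≤ |g x (idx x)| := by
    have hmax : ∀ w : Fin n → ℝ, w ≠ 0 → ∃ i, ∀ j, w j ≤ w i := fun w hw => by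
      have : Nonempty (Fin n) := by
        obtain ⟨i, -⟩ := Function.ne_iff.1 hw
        exact ⟨i⟩
      exact Finite.exists_max w
    choose φ hφ using hmax
    have habs : ∀ x, |g x| ≠ 0 := fun x => mt (fun h => funext fun i => abs_eq_zero.1 (congrFun h i)) (hg0 x)
    -- The index is chosen as a function of the vector `|g x|`, which is the same at `x` and `A x`;
    -- this makes the labeling antipodal even when the maximum is attained several times.
    have hcongr : ∀ w w' hw hw', w = w' → φ w hw = φ w' hw' := by
      rintro w _ _ _ rfl
      rfl
    refine ⟨fun x => φ |g x| (habs x), fun x => hcongr _ _ _ _ (by rw [hgA, abs_neg]), fun x => ?_⟩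
    exact (hcg x).trans ((pi_norm_le_iff_of_nonneg (abs_nonneg _)).2 fun j => hφ _ (habs x) j)
  obtain ⟨δ, hδ, hgδ⟩ := Metric.uniformContinuous_iff.1
    (CompactSpace.uniformContinuous_of_continuous hgcont) c hc
  obtain ⟨T, hT⟩ := hA.exists_fine_antipodalTriangulation hK hinv hfree hδ
  have hr0 : ∀ x, g x (idx x) ≠ 0 := fun x => abs_pos.1 (hc.trans_le (hidx x))
  obtain ⟨u, v, -, ⟨s, hs, hsuv⟩, huv⟩ := h T
    (fun v => signLabel (idx (T.point v)) (g (T.point v) (idx (T.point v)))) fun v => by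
      dsimp only
      rw [T.point_antipode, hidxA, hgA, Pi.neg_apply, signLabel_neg _ (hr0 _)]
  obtain ⟨hi, hsign⟩ := eq_of_signLabel_eq_neg huv
  have hmem : ∀ w : T.Vertex, w = u ∨ w = v → T.point w ∈ simplexCarrier T.homeo s := by
    intro w hw
    apply T.point_mem_simplexCarrier
    rw [← Finset.mem_coe, hsuv]
    exact hw.imp (congrArg _) (congrArg _)
  -- The ends of a complementary edge share the dominant coordinate, where `g` has modulus at least
  -- `c` and opposite signs; this contradicts a difference below `c`.
  have hlt := hgδ (hT s hs _ (hmem u (Or.inl rfl)) _ (hmem v (Or.inr rfl)))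
  have hlt' := (dist_le_pi_dist (g (T.point u)) (g (T.point v)) (idx (T.point u))).trans_lt hlt
  have hu := hidx (T.point u)
  have hv := hidx (T.point v)
  rw [← hi] at hv hsign
  rw [Real.dist_eq, abs_lt] at hlt'
  by_cases h1 : 0 < g (T.point u) (idx (T.point u))
  · rw [abs_of_pos h1] at hu
    have h2 := not_lt.1 (hsign.1 h1)
    linarith [hlt'.2]
  · have h2 := not_not.1 (mt hsign.2 h1)
    rw [abs_of_pos h2] at hv
    linarith [hlt'.1]

end TuckerToBorsukUlam

theorem theorem2p2 {E : Type*} [NormedAddCommGroup E] [NormedSpace ℝ E]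
    (K : Geometry.SimplicialComplex ℝ E) (hK : K.faces.Finite)
    (A : K.space → K.space) (hA : IsSimplicialSelfMap K A)
    (hinv : Function.Involutive A) (hfree : ∀ x, A x ≠ x) (n : ℕ) :
    List.TFAE [
      IsBUTSpace K.space A n,
      IsDiscreteTuckerSpace K.space A n,
      IsKyFanSpace K.space A n,
      IsPSpace K.space A n] := by
  tfae_have 1 → 4 := fun h => h.isPSpace hinv
  tfae_have 4 → 2 := fun h => h.isDiscreteTuckerSpace
  tfae_have 2 → 1 := fun h => h.isBUTSpace hK hA hinv hfree
  tfae_have 1 → 3 := fun h => h.isKyFanSpace hinv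
  tfae_have 3 → 2 := fun h => h.isDiscreteTuckerSpace
  tfae_finish
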